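/- Let $\alpha_1,\alpha_2>0$ be such that $\alpha_1<\alpha_2<\alpha_1+\tfrac12$, let $c_1>0$ and $c_2\in\mathbb{R}$, and let $(\mu_n)_{n\ge 1}$ be a non-increasing sequence of positive real numbers such that \[ \mu_n=\frac{c_1}{n^{\alpha_1}}+\frac{c_2}{n^{\alpha_2}}+o_{n\to\infty}\!\left(\frac{1}{n^{\alpha_2}}\right). \] Let \[ \mathcal{E}_2=\Big\{x\in\ell^2(\mathbb{N}^*;\mathbb{R})\ :\ \Big(\sum_{n=1}^\infty |x_n/\mu_n|^2\Big)^{1/2}\le 1\Big\} \] be the $2$-ellipsoid with semi-axes $(\mu_n)_{n\ge1}$. For $\varepsilon>0$ let $N(\varepsilon;\mathcal{E}_2,\|\cdot\|_2)$ be the smallest cardinality of a set of points of $\ell^2(\mathbb{N}^*;\mathbb{R})$ such that every element of $\mathcal{E}_2$ is within $\ell^2$-distance at most $\varepsilon$ of one of them, and let $H(\varepsilon;\mathcal{E}_2,\|\cdot\|_2)=\log_2 N(\varepsilon;\mathcal{E}_2,\|\cdot\|_2)$ be the metric entropy. Then $N(\varepsilon;\mathcal{E}_2,\|\cdot\|_2)$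 is finite for every $\varepsilon>0$ and, as $\varepsilon\to0^+$, \[ H(\varepsilon;\mathcal{E}_2,\|\cdot\|_2) =\frac{\alpha_1 c_1^{1/\alpha_1}}{\ln 2}\,\varepsilon^{-\frac{1}{\alpha_1}} +\frac{c_2\,c_1^{\frac{1-\alpha_2}{\alpha_1}}}{\ln(2)\,(\alpha_1-\alpha_2+1)}\,\varepsilon^{-\frac{\alpha_1-\alpha_2+1}{\alpha_1}} +o\!\left(\varepsilon^{-\frac{\alpha_1-\alpha_2+1}{\alpha_1}}\right). \] -/

import Mathlib

open Filter Topology Asymptotics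
open scoped ENNReal

/-- The sequence space `ℓ²(ℕ*; ℝ)` of real square-summable sequences indexed by the positive
integers, with its usual norm. -/
abbrev EllTwo : Type := lp (fun _ : ℕ+ => ℝ) 2

/-- The `2`-ellipsoid norm `(∑ₙ |xₙ / μₙ|²)^{1/2}` with semi-axes `μ`; it takes the value `∞` when
the series diverges. -/
noncomputable def ellipsoidNorm (μ : ℕ+ → ℝ) (x : EllTwo) : ℝ≥0∞ :=
  (∑' n : ℕ+, ENNReal.ofReal (|x n / μ n| ^ 2)) ^ (1 / 2 : ℝ)

/-- The infinite-dimensional `2`-ellipsoid with semi-axes `μ`. -/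
def ellipsoid (μ : ℕ+ → ℝ) : Set EllTwo :=
  {x | ellipsoidNorm μ x ≤ 1}

/-- The `ε`-covering number of `K`: the least cardinality of a set of centres in the ambient
space such that every point of `K` is at distance at most `ε` from some centre
(`⊤` if there is no finite such set). -/
noncomputable def coveringNum {X : Type*} [PseudoMetricSpace X] (ε : ℝ) (K : Set X) : ℕ∞ :=
  Metric.externalCoveringNumber ε.toNNReal K

/-- The metric entropy of `K`: the logarithm to base `2` of the `ε`-covering number
(meaningful when the covering number is finite). -/
noncomputable def metricEntropy {X : Type*} [PseudoMetricSpace X] (ε : ℝ) (K : Set X) : ℝ :=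
  Real.logb 2 ((coveringNum ε K).toNat : ℝ)

/-! ### Gaussian moments, exponential tilting and product densities. -/

section Gaussian

open MeasureTheory ProbabilityTheory
open scoped NNReal

/-! Write R = (c₁/ε)^(1/α₁) and p = α₁ - α₂ + 1. The natural logarithm of the covering number is the
sum of log (μₙ/ε) over the axes longer than ε, up to o(R^p).

Lower bound: restricting to finitely many coordinates F and comparing volumes, a cover needs at
least ∏ μₙ/ε balls (`prod_le_card_of_cover`).

Upper bound: a random codebook, as in rate-distortion theory. Let F be the axes longer than ε, A the
sum over F of 1 - (ε/μₙ)², and consider points x whose energy, weighted by 1 - (ε/μₙ)², is about tA.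
Draw centres with independent Gaussian coordinates of variance t(μₙ² - ε²). Tilting this law by
exp(-|x-y|²/(2tε²)) gives another product of Gaussians, under which |x-y|² concentrates by
Chebyshev. Undoing the tilt, a random centre is close enough to x with probability at least ∏ (ε/μₙ)
· exp(-O(√A)) (`pi_gaussianReal_ball_ge`). Greedy selection (`exists_finset_hitting`) then covers a
finite net by about the inverse of this probability, times the logarithm of the size of the net.
That logarithm and the number of energy classes are polynomial in R, so they cost O(log R) in the
entropy (`log_coveringNum_le`). The radius obtained exceeds ε by a factor 1 + O(1/√R); starting from
a smaller radius costs O(√R), since about R axes matter. The hypothesis α₂ < α₁ + 1/2 says p > 1/2,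
which makes this negligible.

Asymptotics: by Stirling's formula (`sum_log_expansion`, `sum_log_div_isLittleO`), D ~ R terms log
(μₙ/ε) add up to α₁(D(log R - log D) + D) + c₂/(c₁p) · R^p + o(R^p). The bracket is at most R, with
equality at D = R, so both bounds agree without a precise count of the axes. -/

lemma pow_four_le_exp (z : ℝ) : z ^ 4 ≤ 24 * (Real.exp z + Real.exp (-z)) := by
  have h := Real.pow_div_factorial_le_exp |z| (abs_nonneg z) 4
  have h1 : Real.exp |z| ≤ Real.exp z + Real.exp (-z) := by
    rcases abs_cases z with ⟨h, _⟩ | ⟨h, _⟩ <;> rw [h] <;>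
      linarith [Real.exp_pos z, Real.exp_pos (-z)]
  have h2 : |z| ^ 4 = z ^ 4 := by
    rw [show (4 : ℕ) = 2 * 2 from rfl, pow_mul, pow_mul, sq_abs]
  rw [h2, show ((Nat.factorial 4 : ℕ) : ℝ) = 24 by norm_num [Nat.factorial],
    div_le_iff₀ (by norm_num)] at h
  linarith

lemma memLp_sub_const_gaussianReal (m : ℝ) (v : ℝ≥0) (c : ℝ) (p : ℝ≥0) :
    MemLp (fun y => y - c) p (gaussianReal m v) :=
  (memLp_id_gaussianReal p).sub (memLp_const c)

lemma integrable_sub_const_pow_gaussianReal (m : ℝ) (v : ℝ≥0) (c : ℝ) (n : ℕ) :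
    Integrable (fun y => (y - c) ^ n) (gaussianReal m v) := by
  have h := (memLp_sub_const_gaussianReal m v c n).integrable_norm_pow'
  refine (integrable_norm_iff (by fun_prop)).1 ?_
  simpa using h

lemma integral_exp_mul_sub_gaussianReal (m : ℝ) (v : ℝ≥0) (b : ℝ) :
    ∫ y, Real.exp (b * (y - m)) ∂gaussianReal m v = Real.exp (v * b ^ 2 / 2) := by
  have h := congrFun (mgf_id_gaussianReal (μ := m) (v := v)) b
  simp only [mgf, id] at h
  have : ∀ y : ℝ, Real.exp (b * (y - m)) = Real.exp (b * y) * Real.exp (-(m * b)) := by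
    intro y
    rw [← Real.exp_add]
    ring_nf
  simp_rw [this]
  rw [integral_mul_const, h, ← Real.exp_add]
  ring_nf

lemma integrable_exp_mul_sub_gaussianReal (m : ℝ) (v : ℝ≥0) (b : ℝ) :
    Integrable (fun y => Real.exp (b * (y - m))) (gaussianReal m v) := by
  have : ∀ y : ℝ, Real.exp (b * (y - m)) = Real.exp (b * y) * Real.exp (-(m * b)) := by
    intro y
    rw [← Real.exp_add]
    ring_nf
  simp_rw [this]
  exact (integrable_exp_mul_gaussianReal b).mul_const _

lemma integral_sub_pow_four_gaussianReal_le (m : ℝ) {v : ℝ≥0} (hv : v ≠ 0) :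
    ∫ y, (y - m) ^ 4 ∂gaussianReal m v ≤ 80 * (v : ℝ) ^ 2 := by
  have hv' : (0 : ℝ) < v := by positivity
  set b : ℝ := (Real.sqrt v)⁻¹ with hb
  have hb2 : b ^ 2 = (v : ℝ)⁻¹ := by rw [hb, inv_pow, Real.sq_sqrt hv'.le]
  have hle : ∀ y : ℝ, (y - m) ^ 4 ≤
      (v : ℝ) ^ 2 * (24 * (Real.exp (b * (y - m)) + Real.exp (-b * (y - m)))) := by
    intro y
    have h := pow_four_le_exp (b * (y - m))
    rw [mul_pow, show b ^ 4 = (b ^ 2) ^ 2 by ring, hb2] at h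
    calc (y - m) ^ 4 = (v : ℝ) ^ 2 * (((v : ℝ)⁻¹) ^ 2 * (y - m) ^ 4) := by field_simp
      _ ≤ _ := by
        rw [neg_mul]
        gcongr
  have hi1 := integrable_exp_mul_sub_gaussianReal m v b
  have hi2 := integrable_exp_mul_sub_gaussianReal m v (-b)
  calc ∫ y, (y - m) ^ 4 ∂gaussianReal m v
      ≤ ∫ y, (v : ℝ) ^ 2 * (24 * (Real.exp (b * (y - m)) + Real.exp (-b * (y - m))))
          ∂gaussianReal m v :=
        integral_mono (integrable_sub_const_pow_gaussianReal m v m 4)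
          (((hi1.add hi2).const_mul 24).const_mul _) hle
    _ = (v : ℝ) ^ 2 * (48 * Real.exp (1 / 2)) := by
        rw [integral_const_mul, integral_const_mul, integral_add hi1 hi2,
          integral_exp_mul_sub_gaussianReal, integral_exp_mul_sub_gaussianReal, neg_sq, hb2,
          mul_inv_cancel₀ hv'.ne']
        ring
    _ ≤ 80 * (v : ℝ) ^ 2 := by
        -- 48 · 5/3 = 80 is the constant of the statement.
        have h : Real.exp (1 / 2) ≤ 5 / 3 := by
          have h1 : Real.exp (1 / 2) ^ 2 = Real.exp 1 := by
            rw [← Real.exp_nat_mul]; norm_num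
          have h2 := Real.exp_one_lt_d9
          by_contra hcon
          push Not at hcon
          nlinarith
        nlinarith [sq_nonneg (v : ℝ)]

lemma integral_sub_sq_gaussianReal (m : ℝ) (v : ℝ≥0) :
    ∫ y, (y - m) ^ 2 ∂gaussianReal m v = v := by
  have h := variance_fun_id_gaussianReal (μ := m) (v := v)
  rw [variance_eq_integral (by fun_prop)] at h
  simpa [integral_id_gaussianReal] using h

lemma integral_sub_gaussianReal (m : ℝ) (v : ℝ≥0) :
    ∫ y, (y - m) ∂gaussianReal m v = 0 := by
  have h := integrable_sub_const_pow_gaussianReal m v 0 1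
  simp only [sub_zero, pow_one] at h
  rw [integral_sub h (integrable_const _)]
  simp [integral_id_gaussianReal]

lemma memLp_two_sq_gaussianReal (m : ℝ) (v : ℝ≥0) (x : ℝ) :
    MemLp (fun y => (x - y) ^ 2) 2 (gaussianReal m v) := by
  rw [memLp_two_iff_integrable_sq (by fun_prop)]
  refine (integrable_sub_const_pow_gaussianReal m v x 4).congr (ae_of_all _ fun y => ?_)
  ring

lemma integral_dist_sq_gaussianReal (m : ℝ) (v : ℝ≥0) (x : ℝ) :
    ∫ y, (x - y) ^ 2 ∂gaussianReal m v = v + (x - m) ^ 2 := by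
  have h1 := integrable_sub_const_pow_gaussianReal m v m 1
  have h2 := integrable_sub_const_pow_gaussianReal m v m 2
  simp only [pow_one] at h1
  have : ∀ y : ℝ, (x - y) ^ 2 = (y - m) ^ 2 + ((-2 * (x - m)) * (y - m) + (x - m) ^ 2) := by
    intro y; ring
  have h3 : Integrable (fun y => -2 * (x - m) * (y - m) + (x - m) ^ 2) (gaussianReal m v) :=
    (h1.const_mul _).add (integrable_const _)
  rw [integral_congr_ae (ae_of_all _ this), integral_add h2 h3,
    integral_add (h1.const_mul _) (integrable_const _), integral_const_mul,
    integral_sub_gaussianReal, integral_sub_sq_gaussianReal]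
  simp

/-- The variance is at most the second moment about any constant. About (x - m)² the deviation is (y
- m)² - 2(x - m)(y - m), and (a - b)² ≤ 2a² + 2b² reduces it to the second and fourth central
moments. -/
lemma variance_dist_sq_gaussianReal_le (m : ℝ) {v : ℝ≥0} (hv : v ≠ 0) (x : ℝ) :
    Var[fun y => (x - y) ^ 2; gaussianReal m v] ≤
      160 * (v : ℝ) ^ 2 + 8 * (x - m) ^ 2 * v := by
  have h2 := integrable_sub_const_pow_gaussianReal m v m 2
  have h4 := integrable_sub_const_pow_gaussianReal m v m 4
  rw [← variance_sub_const (by fun_prop) ((x - m) ^ 2)]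
  refine (variance_le_expectation_sq (by fun_prop)).trans ?_
  calc ∫ y, ((fun y => (x - y) ^ 2 - (x - m) ^ 2) ^ 2) y ∂gaussianReal m v
      ≤ ∫ y, (2 * (y - m) ^ 4 + 8 * (x - m) ^ 2 * (y - m) ^ 2) ∂gaussianReal m v := by
        refine integral_mono_of_nonneg (ae_of_all _ fun y => ?_)
          ((h4.const_mul _).add (h2.const_mul _)) (ae_of_all _ fun y => ?_)
        · simp only [Pi.pow_apply, Pi.zero_apply]
          positivity
        · simp only [Pi.pow_apply]
          nlinarith [sq_nonneg ((y - m) ^ 2 + 2 * (x - m) * (y - m))]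
    _ ≤ _ := by
        rw [integral_add (h4.const_mul _) (h2.const_mul _), integral_const_mul,
          integral_const_mul, integral_sub_sq_gaussianReal]
        linarith [integral_sub_pow_four_gaussianReal_le m hv]

/-- A centred Gaussian is an exponential tilt, by the squared distance to `x`, of a Gaussian
centred near `x`. -/
lemma gaussianReal_eq_withDensity_tilt {ε μ t : ℝ} (hε : 0 < ε) (hμ : ε < μ) (ht : 0 < t) (x : ℝ) :
    gaussianReal 0 (t * μ ^ 2 * (1 - (ε / μ) ^ 2)).toNNReal =
      (gaussianReal (x * (1 - (ε / μ) ^ 2)) (t * ε ^ 2 * (1 - (ε / μ) ^ 2)).toNNReal).withDensity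
        fun y => ENNReal.ofReal
          (ε / μ * Real.exp ((x - y) ^ 2 / (2 * t * ε ^ 2) - (x / μ) ^ 2 / (2 * t))) := by
  have hμ0 : 0 < μ := hε.trans hμ
  have ha : 0 < 1 - (ε / μ) ^ 2 := by
    have : ε / μ < 1 := (div_lt_one hμ0).2 hμ
    have h0 : 0 < ε / μ := by positivity
    nlinarith
  set a := 1 - (ε / μ) ^ 2 with ha_def
  have hv1 : 0 < t * μ ^ 2 * a := by positivity
  have hv2 : 0 < t * ε ^ 2 * a := by positivity
  have hv1' : (t * μ ^ 2 * a).toNNReal ≠ 0 := by simpa using hv1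
  have hv2' : (t * ε ^ 2 * a).toNNReal ≠ 0 := by simpa using hv2
  rw [gaussianReal_of_var_ne_zero _ hv1', gaussianReal_of_var_ne_zero _ hv2',
    ← withDensity_mul _ (by fun_prop) (by fun_prop)]
  congr 1
  ext y
  rw [Pi.mul_apply, gaussianPDF, gaussianPDF, ← ENNReal.ofReal_mul (gaussianPDFReal_nonneg _ _ _)]
  congr 1
  rw [gaussianPDFReal, gaussianPDFReal, Real.coe_toNNReal _ hv1.le, Real.coe_toNNReal _ hv2.le]
  have hs : Real.sqrt (2 * Real.pi * (t * μ ^ 2 * a)) = μ * Real.sqrt (2 * Real.pi * (t * a)) := by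
    rw [show 2 * Real.pi * (t * μ ^ 2 * a) = μ ^ 2 * (2 * Real.pi * (t * a)) by ring,
      Real.sqrt_mul (by positivity), Real.sqrt_sq hμ0.le]
  have hs2 : Real.sqrt (2 * Real.pi * (t * ε ^ 2 * a)) = ε * Real.sqrt (2 * Real.pi * (t * a)) := by
    rw [show 2 * Real.pi * (t * ε ^ 2 * a) = ε ^ 2 * (2 * Real.pi * (t * a)) by ring,
      Real.sqrt_mul (by positivity), Real.sqrt_sq hε.le]
  rw [hs, hs2]
  -- Completing the square: since tμ²a = t(μ² - ε²), the precisions 1/(t(μ² - ε²)) and 1/(tε²) add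
  -- up to 1/(tε²a), and the mean moves from 0 to xa.
  have hexp : -(y - 0) ^ 2 / (2 * (t * μ ^ 2 * a)) = -(y - x * a) ^ 2 / (2 * (t * ε ^ 2 * a)) +
      ((x - y) ^ 2 / (2 * t * ε ^ 2) - (x / μ) ^ 2 / (2 * t)) := by
    have hε2 : ε ^ 2 = (1 - a) * μ ^ 2 := by
      rw [ha_def]; field_simp; ring
    have h1a : 1 - a ≠ 0 := by
      rw [ha_def]; simp; exact ⟨hε.ne', hμ0.ne'⟩
    rw [hε2]
    field_simp
    ring
  rw [hexp, Real.exp_add]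
  have : 0 < Real.sqrt (2 * Real.pi * (t * a)) := by positivity
  field_simp

/-- On boxes both sides factor, because functions of distinct coordinates are independent under a
product measure. This lifts the one-dimensional tilt to the product. -/
lemma pi_withDensity {ι : Type*} [Fintype ι] {α : ι → Type*} [∀ i, MeasurableSpace (α i)]
    (Q : ∀ i, Measure (α i)) [∀ i, IsProbabilityMeasure (Q i)] (f : ∀ i, α i → ℝ≥0∞)
    (hf : ∀ i, Measurable (f i)) [∀ i, SigmaFinite ((Q i).withDensity (f i))] :
    Measure.pi (fun i => (Q i).withDensity (f i)) =
      (Measure.pi Q).withDensity fun c => ∏ i, f i (c i) := by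
  refine Measure.pi_eq fun s hs => ?_
  rw [withDensity_apply _ (MeasurableSet.univ_pi hs), ← lintegral_indicator (MeasurableSet.univ_pi hs)]
  have h : ∀ c : (∀ i, α i), (Set.univ.pi s).indicator (fun c => ∏ i, f i (c i)) c =
      ∏ i, (s i).indicator (f i) (c i) := by
    intro c
    by_cases hc : c ∈ Set.univ.pi s
    · rw [Set.indicator_of_mem hc]
      exact Finset.prod_congr rfl fun i _ => by rw [Set.indicator_of_mem (hc i trivial)]
    · rw [Set.indicator_of_notMem hc]
      simp only [Set.mem_pi, Set.mem_univ, true_imp_iff, not_forall] at hc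
      obtain ⟨i, hi⟩ := hc
      exact (Finset.prod_eq_zero (Finset.mem_univ i) (by rw [Set.indicator_of_notMem hi])).symm
  simp_rw [h]
  have hm : ∀ i, Measurable ((s i).indicator (f i)) := fun i => (hf i).indicator (hs i)
  rw [lintegral_prod_eq_prod_lintegral_of_indepFun Finset.univ
    (fun i (c : ∀ i, α i) => (s i).indicator (f i) (c i))
    (iIndepFun_pi fun i => (hm i).aemeasurable) fun i => (hm i).comp (measurable_pi_apply i)]
  refine Finset.prod_congr rfl fun i _ => ?_
  rw [withDensity_apply _ (hs i), ← lintegral_indicator (hs i)]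
  exact (measurePreserving_eval Q i).lintegral_comp (hm i)

end Gaussian

/-! ### Probability that a random Gaussian centre falls near a given point. -/

section Hit

open MeasureTheory ProbabilityTheory
open scoped NNReal

/-- Under a product of Gaussians tilted towards `x`, the squared distance to `x` is concentrated. -/
lemma half_le_pi_gaussianReal_dist_sq {ι : Type*} [Fintype ι] (m x : ι → ℝ) (v : ι → ℝ≥0)
    (hv : ∀ i, v i ≠ 0) {E τ : ℝ} (hE : ∑ i, ((v i : ℝ) + (x i - m i) ^ 2) = E) (hτ : 0 < τ)
    (hvar : ∑ i, (160 * (v i : ℝ) ^ 2 + 8 * (x i - m i) ^ 2 * v i) ≤ τ ^ 2 / 2) :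
    ENNReal.ofReal (1 / 2) ≤ Measure.pi (fun i => gaussianReal (m i) (v i))
      {c : ι → ℝ | |∑ i, (x i - c i) ^ 2 - E| < τ} := by
  set Q := Measure.pi (fun i => gaussianReal (m i) (v i)) with hQ
  set X : ι → (ι → ℝ) → ℝ := fun i c => (x i - c i) ^ 2 with hX
  have hmp : ∀ i, MeasurePreserving (Function.eval i) Q (gaussianReal (m i) (v i)) := fun i =>
    measurePreserving_eval _ i
  have hL : ∀ i, MemLp (X i) 2 Q := fun i =>
    (memLp_two_sq_gaussianReal (m i) (v i) (x i)).comp_measurePreserving (hmp i)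
  have hind : iIndepFun X Q := iIndepFun_pi (X := fun i y => (x i - y) ^ 2) fun i => by fun_prop
  have hmean : ∫ c, (∑ i, X i) c ∂Q = E := by
    simp only [Finset.sum_apply]
    rw [integral_finsetSum _ fun i _ => (hL i).integrable (by norm_num), ← hE]
    refine Finset.sum_congr rfl fun i _ => ?_
    rw [← integral_dist_sq_gaussianReal, ← (hmp i).map_eq,
      integral_map (hmp i).measurable.aemeasurable (by fun_prop)]
  have hV : Var[∑ i, X i; Q] ≤ τ ^ 2 / 2 := by
    rw [IndepFun.variance_sum (fun i _ => hL i) fun i _ j _ hij => hind.indepFun hij]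
    refine (Finset.sum_le_sum fun i _ => ?_).trans hvar
    refine le_trans (le_of_eq ?_) (variance_dist_sq_gaussianReal_le (m i) (hv i) (x i))
    exact (hmp i).variance_fun_comp (f := fun y => (x i - y) ^ 2) (by fun_prop)
  have hcheb := meas_ge_le_variance_div_sq
    (memLp_finsetSum' (f := X) Finset.univ fun i _ => hL i) hτ
  rw [hmean] at hcheb
  have hle : Q {c | τ ≤ |(∑ i, X i) c - E|} ≤ ENNReal.ofReal (1 / 2) := by
    refine hcheb.trans (ENNReal.ofReal_le_ofReal ?_)
    rw [div_le_iff₀ (by positivity)]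
    linarith
  have hset : {c : ι → ℝ | |∑ i, (x i - c i) ^ 2 - E| < τ} = {c | τ ≤ |(∑ i, X i) c - E|}ᶜ := by
    ext c
    simp [hX, Finset.sum_apply]
  have hmeas : MeasurableSet {c | τ ≤ |(∑ i, X i) c - E|} := by
    refine measurableSet_le measurable_const ?_
    simp only [Finset.sum_apply, hX]
    fun_prop
  rw [hset, prob_compl_eq_one_sub hmeas]
  calc ENNReal.ofReal (1 / 2) = 1 - ENNReal.ofReal (1 / 2) := by
        rw [← ENNReal.ofReal_one, ← ENNReal.ofReal_sub _ (by norm_num)]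
        norm_num
    _ ≤ _ := tsub_le_tsub_left hle 1

/-- A product of centred Gaussians with variances `t (μᵢ² - ε²)` gives the ball about a point `x`
a mass that is, up to subexponential factors, the volume ratio `∏ ε / μᵢ`. -/
lemma pi_gaussianReal_ball_ge {ι : Type*} [Fintype ι] (μ x : ι → ℝ) {ε t A s : ℝ} (hε : 0 < ε)
    (hμ : ∀ i, ε < μ i) (ht : 0 < t) (hA : ∑ i, (1 - (ε / μ i) ^ 2) = A) (hA1 : 1 ≤ A)
    (hs : ∑ i, (x i / μ i) ^ 2 * (1 - (ε / μ i) ^ 2) = s) (hs1 : t * A ≤ s)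
    (hs2 : s ≤ t * (A + Real.sqrt A)) :
    ENNReal.ofReal ((∏ i, ε / μ i) * Real.exp (-(11 * Real.sqrt A)) / 2) ≤
      Measure.pi (fun i => gaussianReal 0 (t * μ i ^ 2 * (1 - (ε / μ i) ^ 2)).toNNReal)
        {c : ι → ℝ | ∑ i, (x i - c i) ^ 2 ≤
          ε ^ 2 * (∑ i, (x i / μ i) ^ 2 + (t * A - s) + 20 * t * Real.sqrt A)} := by
  have hμ0 : ∀ i, 0 < μ i := fun i => hε.trans (hμ i)
  have ha : ∀ i, 0 < 1 - (ε / μ i) ^ 2 := by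
    intro i
    have h1 : ε / μ i < 1 := (div_lt_one (hμ0 i)).2 (hμ i)
    have h0 : 0 < ε / μ i := div_pos hε (hμ0 i)
    nlinarith
  have ha1 : ∀ i, 1 - (ε / μ i) ^ 2 ≤ 1 := fun i => by linarith [sq_nonneg (ε / μ i)]
  set U := ∑ i, (x i / μ i) ^ 2 with hU
  set q := Real.sqrt A with hq
  have hq1 : 1 ≤ q := Real.one_le_sqrt.2 hA1
  have hqA : q ^ 2 = A := Real.sq_sqrt (by linarith)
  set Q := Measure.pi (fun i => gaussianReal (x i * (1 - (ε / μ i) ^ 2))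
    (t * ε ^ 2 * (1 - (ε / μ i) ^ 2)).toNNReal) with hQ
  set f : ι → ℝ → ℝ := fun i y =>
    ε / μ i * Real.exp ((x i - y) ^ 2 / (2 * t * ε ^ 2) - (x i / μ i) ^ 2 / (2 * t)) with hf
  have hP : Measure.pi (fun i => gaussianReal 0 (t * μ i ^ 2 * (1 - (ε / μ i) ^ 2)).toNNReal) =
      Q.withDensity fun c => ∏ i, ENNReal.ofReal (f i (c i)) := by
    have h1 := fun i => gaussianReal_eq_withDensity_tilt hε (hμ i) ht (x i)
    have : ∀ i, SigmaFinite ((gaussianReal (x i * (1 - (ε / μ i) ^ 2))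
        (t * ε ^ 2 * (1 - (ε / μ i) ^ 2)).toNNReal).withDensity
          fun y => ENNReal.ofReal (f i y)) := fun i => by
      rw [← h1 i]
      infer_instance
    rw [hQ, ← pi_withDensity _ (fun i y => ENNReal.ofReal (f i y)) fun i => by fun_prop]
    congr 1
    ext1 i
    exact h1 i
  -- `E` is the mean of the squared distance under the tilted law `Q`. Its variance is at most
  -- 160t²ε⁴A + 8tε⁴s ≤ 176t²ε⁴A, below τ²/2 = 200t²ε⁴A.
  set τ : ℝ := 20 * t * q * ε ^ 2 with hτ
  set E : ℝ := ε ^ 2 * (t * A + U - s) with hE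
  set G : Set (ι → ℝ) := {c | |∑ i, (x i - c i) ^ 2 - E| < τ} with hG
  have hvpos : ∀ i, 0 < t * ε ^ 2 * (1 - (ε / μ i) ^ 2) := fun i => by
    have := ha i
    positivity
  have hb : ∀ i, (x i - x i * (1 - (ε / μ i) ^ 2)) ^ 2 =
      ε ^ 2 * ((x i / μ i) ^ 2 - (x i / μ i) ^ 2 * (1 - (ε / μ i) ^ 2)) := by
    intro i
    have := (hμ0 i).ne'
    field_simp
    ring
  have hQG : ENNReal.ofReal (1 / 2) ≤ Q G := by
    refine half_le_pi_gaussianReal_dist_sq _ x _ (fun i => by simpa using hvpos i) ?_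
      (by positivity) ?_
    · rw [hE, hU, ← hs, ← hA, Finset.mul_sum, ← Finset.sum_add_distrib, ← Finset.sum_sub_distrib,
        Finset.mul_sum]
      refine Finset.sum_congr rfl fun i _ => ?_
      rw [Real.coe_toNNReal _ (hvpos i).le, hb]
      ring
    · calc ∑ i, (160 * ((t * ε ^ 2 * (1 - (ε / μ i) ^ 2)).toNNReal : ℝ) ^ 2 +
            8 * (x i - x i * (1 - (ε / μ i) ^ 2)) ^ 2 *
              ((t * ε ^ 2 * (1 - (ε / μ i) ^ 2)).toNNReal : ℝ))
          ≤ ∑ i, (160 * t ^ 2 * ε ^ 4 * (1 - (ε / μ i) ^ 2) +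
              8 * t * ε ^ 4 * ((x i / μ i) ^ 2 * (1 - (ε / μ i) ^ 2))) := by
            refine Finset.sum_le_sum fun i _ => ?_
            rw [Real.coe_toNNReal _ (hvpos i).le, hb]
            have h1 := ha i
            have h2 := ha1 i
            have h3 := sq_nonneg (x i / μ i)
            set a := 1 - (ε / μ i) ^ 2
            set u := (x i / μ i) ^ 2
            have h4 : a ^ 2 ≤ a := by nlinarith
            have h5 : u * (1 - a) * a ≤ u * a := by
              have : u * (1 - a) ≤ u := by nlinarith
              exact mul_le_mul_of_nonneg_right this h1.le
            have e1 : 160 * (t * ε ^ 2 * a) ^ 2 + 8 * (ε ^ 2 * (u - u * a)) * (t * ε ^ 2 * a) =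
              160 * t ^ 2 * ε ^ 4 * a ^ 2 + 8 * t * ε ^ 4 * (u * (1 - a) * a) := by ring
            rw [e1]
            gcongr
        _ = 160 * t ^ 2 * ε ^ 4 * A + 8 * t * ε ^ 4 * s := by
            rw [Finset.sum_add_distrib, ← Finset.mul_sum, ← Finset.mul_sum, hA, hs]
        _ ≤ 160 * t ^ 2 * ε ^ 4 * A + 8 * t * ε ^ 4 * (t * (A + A)) := by
            have : q ≤ A := by nlinarith
            have h2 : s ≤ t * (A + A) := hs2.trans (by gcongr)
            gcongr
        _ ≤ τ ^ 2 / 2 := by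
            rw [hτ, mul_pow, mul_pow, hqA]
            have : 0 ≤ t ^ 2 * ε ^ 4 * A := by positivity
            nlinarith
  set K : ℝ := (∏ i, ε / μ i) * Real.exp (-(11 * q)) with hK
  have hprod0 : 0 < ∏ i, ε / μ i := Finset.prod_pos fun i _ => div_pos hε (hμ0 i)
  have hdens : ∀ c ∈ G, ENNReal.ofReal K ≤ ∏ i, ENNReal.ofReal (f i (c i)) := by
    intro c hc
    rw [← ENNReal.ofReal_prod_of_nonneg fun i _ => by
      have := hμ0 i
      positivity]
    refine ENNReal.ofReal_le_ofReal ?_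
    rw [Finset.prod_mul_distrib, ← Real.exp_sum]
    refine mul_le_mul_of_nonneg_left (Real.exp_le_exp.2 ?_) hprod0.le
    rw [Finset.sum_sub_distrib, ← Finset.sum_div, ← Finset.sum_div, ← hU]
    have h1 := (abs_lt.1 (show |∑ i, (x i - c i) ^ 2 - E| < τ from hc)).1
    have h2 : ε ^ 2 * (t * A + U - s - 20 * t * q) ≤ ∑ i, (x i - c i) ^ 2 := by
      rw [hE, hτ] at h1
      linarith
    have h3 : ε ^ 2 * (t * A + U - s - 20 * t * q) / (2 * t * ε ^ 2) ≤
        (∑ i, (x i - c i) ^ 2) / (2 * t * ε ^ 2) := by gcongr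
    have h4 : ε ^ 2 * (t * A + U - s - 20 * t * q) / (2 * t * ε ^ 2) - U / (2 * t) =
        (t * A - s - 20 * t * q) / (2 * t) := by
      field_simp
      ring
    -- As s - tA ≤ tq, the exponent is at least -(1 + 20)q/2.
    have h5 : -(11 * q) ≤ (t * A - s - 20 * t * q) / (2 * t) := by
      rw [le_div_iff₀ (by positivity)]
      nlinarith
    linarith
  have hGm : MeasurableSet G := by
    refine measurableSet_lt ?_ measurable_const
    fun_prop
  calc ENNReal.ofReal (K / 2) = ENNReal.ofReal K * ENNReal.ofReal (1 / 2) := by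
        rw [← ENNReal.ofReal_mul (by positivity)]
        ring_nf
    _ ≤ ENNReal.ofReal K * Q G := by gcongr
    _ = ∫⁻ _ in G, ENNReal.ofReal K ∂Q := by rw [setLIntegral_const]
    _ ≤ ∫⁻ c in G, ∏ i, ENNReal.ofReal (f i (c i)) ∂Q := setLIntegral_mono' hGm hdens
    _ = Q.withDensity (fun c => ∏ i, ENNReal.ofReal (f i (c i))) G := by
        rw [withDensity_apply _ hGm]
    _ ≤ Q.withDensity (fun c => ∏ i, ENNReal.ofReal (f i (c i)))
          {c : ι → ℝ | ∑ i, (x i - c i) ^ 2 ≤ ε ^ 2 * (U + (t * A - s) + 20 * t * q)} := by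
        refine measure_mono fun c hc => ?_
        have h1 := (abs_lt.1 (show |∑ i, (x i - c i) ^ 2 - E| < τ from hc)).2
        change ∑ i, (x i - c i) ^ 2 ≤ _
        rw [hE, hτ] at h1
        linarith
    _ = _ := by rw [hP]

end Hit

/-! ### Points of the ellipsoid and their finite truncations. -/

section Ellipsoid

lemma EllTwo.norm_le_of_sum_sq_le {x : EllTwo} {C : ℝ} (hC : 0 ≤ C)
    (h : ∀ s : Finset ℕ+, ∑ n ∈ s, x n ^ 2 ≤ C ^ 2) : ‖x‖ ≤ C := by
  refine lp.norm_le_of_forall_sum_le (by norm_num) hC fun s => ?_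
  simpa using h s

lemma EllTwo.sum_sq_le (x : EllTwo) (s : Finset ℕ+) : ∑ n ∈ s, x n ^ 2 ≤ ‖x‖ ^ 2 := by
  simpa using lp.sum_rpow_le_norm_rpow (p := 2) (by norm_num) x s

lemma mem_ellipsoid_iff {μ : ℕ+ → ℝ} {x : EllTwo} :
    x ∈ ellipsoid μ ↔ ∀ s : Finset ℕ+, ∑ n ∈ s, (x n / μ n) ^ 2 ≤ 1 := by
  have h1 : x ∈ ellipsoid μ ↔ ∑' n : ℕ+, ENNReal.ofReal (|x n / μ n| ^ 2) ≤ 1 := by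
    change (∑' n : ℕ+, ENNReal.ofReal (|x n / μ n| ^ 2)) ^ (1 / 2 : ℝ) ≤ 1 ↔ _
    constructor
    · intro h
      by_contra hcon
      exact absurd h (not_le.2 (ENNReal.one_lt_rpow (not_le.1 hcon) (by norm_num)))
    · intro h
      exact ENNReal.rpow_le_one h (by norm_num)
  rw [h1, ENNReal.tsum_eq_iSup_sum, iSup_le_iff]
  refine forall_congr' fun s => ?_
  rw [← ENNReal.ofReal_sum_of_nonneg fun _ _ => by positivity, ENNReal.ofReal_le_one]
  simp

/-- The sequence supported on a finite set `F` with prescribed values there. -/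
noncomputable def EllTwo.extend (F : Finset ℕ+) (c : F → ℝ) : EllTwo :=
  ⟨fun n => if h : n ∈ F then c ⟨n, h⟩ else 0, by
    refine memℓp_gen (summable_of_ne_finset_zero (s := F) fun n hn => ?_)
    simp [hn]⟩

lemma EllTwo.extend_apply_coe (F : Finset ℕ+) (c : F → ℝ) (n : F) :
    EllTwo.extend F c n = c n := by
  change (if h : (n : ℕ+) ∈ F then c ⟨n, h⟩ else 0) = c n
  simp

lemma EllTwo.extend_apply_of_notMem (F : Finset ℕ+) (c : F → ℝ) {n : ℕ+} (hn : n ∉ F) :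
    EllTwo.extend F c n = 0 := by
  change (if h : n ∈ F then c ⟨n, h⟩ else 0) = 0
  simp [hn]

/-- On the short axes xₙ² ≤ ε²(xₙ/μₙ)², so the tail can only spend the part of the ellipsoid's unit
budget that `F` leaves. This is sharper than a tail bound of ε², and it cancels the energy term in
the radius of `pi_gaussianReal_ball_ge`. -/
lemma sum_sq_le_of_mem_ellipsoid {μ : ℕ+ → ℝ} (hμ : ∀ n, 0 < μ n) {x : EllTwo}
    (hx : x ∈ ellipsoid μ) {ε : ℝ} {F s : Finset ℕ+} (hF : ∀ n ∉ F, μ n ≤ ε) :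
    ∑ n ∈ s \ F, x n ^ 2 ≤ ε ^ 2 * (1 - ∑ n ∈ F, (x n / μ n) ^ 2) := by
  have h1 : ∑ n ∈ s \ F, x n ^ 2 ≤ ∑ n ∈ s \ F, ε ^ 2 * (x n / μ n) ^ 2 := by
    refine Finset.sum_le_sum fun n hn => ?_
    have h2 := hF n (Finset.mem_sdiff.1 hn).2
    have h3 := hμ n
    calc x n ^ 2 = μ n ^ 2 * (x n / μ n) ^ 2 := by field_simp
      _ ≤ _ := by gcongr
  have h4 := mem_ellipsoid_iff.1 hx (s \ F ∪ F)
  rw [Finset.sum_union Finset.sdiff_disjoint] at h4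
  rw [← Finset.mul_sum] at h1
  refine h1.trans ?_
  gcongr
  linarith

lemma sum_le_sum_add_sum_sdiff {F s : Finset ℕ+} {f : ℕ+ → ℝ} (hf : ∀ n, 0 ≤ f n) :
    ∑ n ∈ s, f n ≤ ∑ n ∈ F, f n + ∑ n ∈ s \ F, f n := by
  rw [add_comm, ← Finset.sum_union Finset.sdiff_disjoint]
  refine Finset.sum_le_sum_of_subset_of_nonneg ?_ fun n _ _ => hf n
  intro n hn
  by_cases h : n ∈ F <;> simp [hn, h]

lemma dist_extend_le {μ : ℕ+ → ℝ} (hμ : ∀ n, 0 < μ n) {x : EllTwo} (hx : x ∈ ellipsoid μ)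
    {ε ρ : ℝ} (hρ : 0 ≤ ρ) {F : Finset ℕ+} (hF : ∀ n ∉ F, μ n ≤ ε) (c : F → ℝ)
    (h : ∑ n : F, (x n - c n) ^ 2 + ε ^ 2 * (1 - ∑ n ∈ F, (x n / μ n) ^ 2) ≤ ρ ^ 2) :
    dist x (EllTwo.extend F c) ≤ ρ := by
  rw [dist_eq_norm]
  refine EllTwo.norm_le_of_sum_sq_le hρ fun s => ?_
  refine le_trans ?_ h
  refine (sum_le_sum_add_sum_sdiff (F := F) fun n => sq_nonneg _).trans ?_
  refine add_le_add (le_of_eq ?_) ?_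
  · rw [← Finset.sum_coe_sort]
    refine Finset.sum_congr rfl fun n _ => ?_
    rw [lp.coeFn_sub, Pi.sub_apply, EllTwo.extend_apply_coe]
  · refine le_trans (le_of_eq ?_) (sum_sq_le_of_mem_ellipsoid hμ hx hF (s := s))
    refine Finset.sum_congr rfl fun n hn => ?_
    rw [lp.coeFn_sub, Pi.sub_apply, EllTwo.extend_apply_of_notMem F c (Finset.mem_sdiff.1 hn).2,
      sub_zero]

end Ellipsoid

/-! ### Derandomisation by greedy selection. -/

section Greedy

open MeasureTheory

/-- If every point of a finite set `T` is hit with probability at least `p`, then `T` is hit by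
some `log #T / p + 1` points. -/
lemma exists_finset_hitting {X Ω : Type*} [MeasurableSpace Ω] (ν : Measure Ω)
    [IsProbabilityMeasure ν] (T : Finset X) (S : X → Set Ω) (hS : ∀ x, MeasurableSet (S x))
    {p : ℝ} (hp : 0 < p) (h : ∀ x ∈ T, ENNReal.ofReal p ≤ ν (S x)) :
    ∃ C : Finset Ω, (C.card : ℝ) ≤ Real.log T.card / p + 1 ∧ ∀ x ∈ T, ∃ c ∈ C, c ∈ S x := by
  classical
  -- The expected number of points of `T'` hit by a random c is at least p · #T', so some c attains
  -- it.
  have hstep : ∀ T' ⊆ T, ∃ c, p * T'.card ≤ ((T'.filter fun x => c ∈ S x).card : ℝ) := by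
    intro T' hT'
    have hint : ∫⁻ c, ∑ x ∈ T', (S x).indicator 1 c ∂ν = ∑ x ∈ T', ν (S x) := by
      rw [lintegral_finsetSum _ fun x _ => measurable_one.indicator (hS x)]
      exact Finset.sum_congr rfl fun x _ => lintegral_indicator_one (hS x)
    obtain ⟨c, hc⟩ := exists_lintegral_le (μ := ν) (f := fun c => ∑ x ∈ T', (S x).indicator 1 c)
      (by rw [hint]; exact (ENNReal.sum_lt_top.2 fun x _ => measure_lt_top ν _).ne)
    refine ⟨c, ?_⟩
    rw [hint] at hc
    have h1 : ∑ x ∈ T', (S x).indicator (1 : Ω → ℝ≥0∞) c =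
        ((T'.filter fun x => c ∈ S x).card : ℝ≥0∞) := by
      rw [Finset.card_filter, Nat.cast_sum]
      refine Finset.sum_congr rfl fun x _ => ?_
      by_cases hx : c ∈ S x <;> simp [hx]
    rw [h1] at hc
    have h2 : ENNReal.ofReal (p * T'.card) ≤ ∑ x ∈ T', ν (S x) := by
      calc ENNReal.ofReal (p * T'.card) = ∑ x ∈ T', ENNReal.ofReal p := by
            rw [Finset.sum_const, nsmul_eq_mul, ENNReal.ofReal_mul hp.le, mul_comm]
            simp
        _ ≤ _ := Finset.sum_le_sum fun x hx => h x (hT' hx)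
    have h3 := h2.trans hc
    rwa [← ENNReal.ofReal_natCast, ENNReal.ofReal_le_ofReal_iff (by positivity)] at h3
  rcases T.eq_empty_or_nonempty with rfl | hTne
  · exact ⟨∅, by simp⟩
  have hp1 : p ≤ 1 := by
    obtain ⟨x, hx⟩ := hTne
    have := (h x hx).trans prob_le_one
    rwa [ENNReal.ofReal_le_one] at this
  -- Each greedy choice shrinks the set of missed points by a factor 1 - p.
  have hind : ∀ N : ℕ, ∃ C : Finset Ω, C.card ≤ N ∧
      ((T.filter fun x => ∀ c ∈ C, c ∉ S x).card : ℝ) ≤ (1 - p) ^ N * T.card := by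
    intro N
    induction N with
    | zero => exact ⟨∅, by simp⟩
    | succ N ih =>
      obtain ⟨C, hC, hle⟩ := ih
      set T' := T.filter fun x => ∀ c ∈ C, c ∉ S x with hT'
      obtain ⟨c, hc⟩ := hstep T' (Finset.filter_subset _ _)
      refine ⟨insert c C, (Finset.card_insert_le _ _).trans (by omega), ?_⟩
      have h1 : (T.filter fun x => ∀ c' ∈ insert c C, c' ∉ S x) =
          T'.filter fun x => ¬ c ∈ S x := by
        ext x
        simp only [hT', Finset.mem_filter, Finset.mem_insert, forall_eq_or_imp]
        tauto
      have h2 := Finset.card_filter_add_card_filter_not (s := T') (fun x => c ∈ S x)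
      have h3 : ((T'.filter fun x => c ∈ S x).card : ℝ) +
          ((T'.filter fun x => ¬ c ∈ S x).card : ℝ) = T'.card := by exact_mod_cast h2
      rw [h1, pow_succ]
      nlinarith
  obtain ⟨C, hC, hle⟩ := hind (⌊Real.log T.card / p⌋₊ + 1)
  have hT0 : (0 : ℝ) < T.card := by exact_mod_cast hTne.card_pos
  have hlog : 0 ≤ Real.log T.card := Real.log_natCast_nonneg _
  refine ⟨C, ?_, ?_⟩
  · calc (C.card : ℝ) ≤ ((⌊Real.log T.card / p⌋₊ + 1 : ℕ) : ℝ) := by exact_mod_cast hC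
      _ ≤ _ := by
        push_cast
        linarith [Nat.floor_le (show 0 ≤ Real.log T.card / p by positivity)]
  -- The number of missed points is a natural number below e^(-pN) · #T < 1, hence zero.
  · have hlt : (1 - p) ^ (⌊Real.log T.card / p⌋₊ + 1) * T.card < 1 := by
      have h1 : (1 - p) ^ (⌊Real.log T.card / p⌋₊ + 1) ≤
          Real.exp (-p * ((⌊Real.log T.card / p⌋₊ + 1 : ℕ) : ℝ)) := by
        rw [mul_comm, Real.exp_nat_mul]
        refine pow_le_pow_left₀ (by linarith) ?_ _
        linarith [Real.add_one_le_exp (-p)]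
      have h2 : Real.log T.card < p * ((⌊Real.log T.card / p⌋₊ + 1 : ℕ) : ℝ) := by
        have := Nat.lt_floor_add_one (Real.log T.card / p)
        rw [div_lt_iff₀ hp] at this
        push_cast
        linarith
      calc _ ≤ Real.exp (-p * ((⌊Real.log T.card / p⌋₊ + 1 : ℕ) : ℝ)) * T.card := by gcongr
        _ < Real.exp (-Real.log T.card) * T.card := by
          gcongr
          linarith
        _ = 1 := by
          rw [Real.exp_neg, Real.exp_log hT0, inv_mul_cancel₀ hT0.ne']
    have h0 : (T.filter fun x => ∀ c ∈ C, c ∉ S x).card = 0 := by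
      have : ((T.filter fun x => ∀ c ∈ C, c ∉ S x).card : ℝ) < 1 := hle.trans_lt hlt
      exact Nat.lt_one_iff.1 (by exact_mod_cast this)
    intro x hx
    by_contra hcon
    push Not at hcon
    have hmem : x ∈ T.filter fun x => ∀ c ∈ C, c ∉ S x := Finset.mem_filter.2 ⟨hx, hcon⟩
    rw [Finset.card_eq_zero.1 h0] at hmem
    exact absurd hmem (Finset.notMem_empty x)

end Greedy

/-! ### Covering the ellipsoid by energy classes. -/

section Cover

open MeasureTheory ProbabilityTheory

/-- The reverse water-filling weight `1 - (ε / μ)²`. -/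
noncomputable def waterWeight (ε μ : ℝ) : ℝ := 1 - (ε / μ) ^ 2

lemma waterWeight_pos {ε μ : ℝ} (hε : 0 < ε) (hμ : ε < μ) : 0 < waterWeight ε μ := by
  have h1 : ε / μ < 1 := (div_lt_one (hε.trans hμ)).2 hμ
  have h0 : 0 < ε / μ := div_pos hε (hε.trans hμ)
  unfold waterWeight
  nlinarith

lemma waterWeight_le_one (ε μ : ℝ) : waterWeight ε μ ≤ 1 := by
  unfold waterWeight
  linarith [sq_nonneg (ε / μ)]

/-- Cover of the points of the ellipsoid whose weighted energy is close to `t A`. -/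
lemma exists_cover_of_energy_class {μ : ℕ+ → ℝ} (hμ : ∀ n, 0 < μ n) {ε A t : ℝ} (hε : 0 < ε)
    {F : Finset ℕ+} (hF : ∀ n, n ∈ F ↔ ε < μ n) (hA : ∑ n ∈ F, waterWeight ε (μ n) = A)
    (hA1 : 1 ≤ A) (ht : 0 < t) (htA : t * A ≤ 1) (T : Finset EllTwo)
    (hT : ∀ x ∈ T, x ∈ ellipsoid μ ∧
      t * A ≤ ∑ n ∈ F, (x n / μ n) ^ 2 * waterWeight ε (μ n) ∧
      ∑ n ∈ F, (x n / μ n) ^ 2 * waterWeight ε (μ n) ≤ t * (A + Real.sqrt A)) :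
    ∃ C : Finset EllTwo,
      (C.card : ℝ) ≤ Real.log T.card /
        ((∏ n ∈ F, ε / μ n) * Real.exp (-(11 * Real.sqrt A)) / 2) + 1 ∧
      ∀ x ∈ T, ∃ c ∈ C, dist x c ≤ ε * (1 + 10 / Real.sqrt A) := by
  classical
  set q := Real.sqrt A with hq
  have hq1 : 1 ≤ q := Real.one_le_sqrt.2 hA1
  have hqA : q ^ 2 = A := Real.sq_sqrt (by linarith)
  have hFμ : ∀ n : F, ε < μ n := fun n => (hF n).1 n.2
  have hprod : 0 < ∏ n ∈ F, ε / μ n := Finset.prod_pos fun n _ => div_pos hε (hμ n)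
  obtain ⟨C, hC, hCT⟩ := exists_finset_hitting
    (Measure.pi (fun n : F => gaussianReal 0 (t * μ n ^ 2 * (1 - (ε / μ n) ^ 2)).toNNReal)) T
    (fun x => {c : F → ℝ | ∑ n : F, (x n - c n) ^ 2 ≤
          ε ^ 2 * (∑ n : F, (x n / μ n) ^ 2 +
            (t * A - ∑ n ∈ F, (x n / μ n) ^ 2 * waterWeight ε (μ n)) + 20 * t * q)})
    (fun x => measurableSet_le (by fun_prop) measurable_const)
    (p := (∏ n ∈ F, ε / μ n) * Real.exp (-(11 * q)) / 2) (by positivity) (by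
      intro x hx
      obtain ⟨-, h1, h2⟩ := hT x hx
      rw [← Finset.prod_coe_sort F]
      refine pi_gaussianReal_ball_ge (fun n : F => μ n) (fun n : F => x n) hε hFμ ht ?_ hA1 ?_
        h1 h2
      · rw [← hA, ← Finset.sum_coe_sort F]
        rfl
      · rw [← Finset.sum_coe_sort F]
        rfl)
  refine ⟨C.image (EllTwo.extend F), ?_, ?_⟩
  · exact le_trans (by exact_mod_cast Finset.card_image_le) hC
  intro x hx
  obtain ⟨c, hcC, hc⟩ := hCT x hx
  obtain ⟨hxE, h1, -⟩ := hT x hx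
  refine ⟨_, Finset.mem_image_of_mem _ hcC, ?_⟩
  refine dist_extend_le hμ hxE (by positivity) (F := F) (ε := ε) (fun n hn => ?_) c ?_
  · exact not_lt.1 fun h => hn ((hF n).2 h)
  · change ∑ n : F, (x n - c n) ^ 2 ≤ _ at hc
    rw [Finset.sum_coe_sort F (fun n => (x n / μ n) ^ 2)] at hc
    -- The head contributes ε²(U + (tA - s) + 20tq) and the tail ε²(1 - U). As s ≥ tA, what remains
    -- is ε²(1 + 20tq), and t ≤ 1/A turns it into at most ε²(1 + 10/q)².
    have h3 : t * q ≤ 1 / q := by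
      rw [le_div_iff₀ (by positivity)]
      calc t * q * q = t * A := by rw [← hqA]; ring
        _ ≤ 1 := htA
    have h5 : 1 + 20 * (t * q) ≤ (1 + 10 / q) ^ 2 := by
      have : (1 + 10 / q) ^ 2 = 1 + 20 * (1 / q) + (10 / q) ^ 2 := by ring
      rw [this]
      nlinarith [sq_nonneg (10 / q)]
    rw [mul_pow]
    have h4 : ε ^ 2 * (1 + 20 * (t * q)) ≤ ε ^ 2 * (1 + 10 / q) ^ 2 := by gcongr
    have h6 : 0 ≤ ε ^ 2 * (∑ n ∈ F, (x n / μ n) ^ 2 * waterWeight ε (μ n) - t * A) :=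
      mul_nonneg (sq_nonneg _) (by linarith)
    linarith

/-- Points of tiny weighted energy need no codebook: xₙ² = μₙ² · (weighted energy of xₙ) +
ε²(xₙ/μₙ)², and the last term joins the tail to give at most ε². -/
lemma dist_zero_le_of_energy_le {μ : ℕ+ → ℝ} (hμ : ∀ n, 0 < μ n) {ε M κ : ℝ} (hε : 0 < ε)
    (hM : ∀ n, μ n ≤ M) (hκ : 0 ≤ κ) {F : Finset ℕ+} (hF : ∀ n, n ∈ F ↔ ε < μ n) {x : EllTwo}
    (hx : x ∈ ellipsoid μ)
    (h : ∑ n ∈ F, (x n / μ n) ^ 2 * waterWeight ε (μ n) ≤ ε ^ 2 * κ / M ^ 2) :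
    dist x 0 ≤ ε * (1 + κ) := by
  have h0 : (0 : EllTwo) = EllTwo.extend F 0 := by
    ext n
    by_cases hn : n ∈ F
    · exact (EllTwo.extend_apply_coe F 0 ⟨n, hn⟩).symm
    · exact (EllTwo.extend_apply_of_notMem F 0 hn).symm
  have hM0 : 0 < M := (hμ 1).trans_le (hM 1)
  rw [h0]
  refine dist_extend_le hμ hx (by positivity) (F := F) (ε := ε) (fun n hn => ?_) 0 ?_
  · exact not_lt.1 fun h => hn ((hF n).2 h)
  have h1 : ∑ n : F, (x n - (0 : F → ℝ) n) ^ 2 ≤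
      M ^ 2 * (ε ^ 2 * κ / M ^ 2) + ε ^ 2 * ∑ n ∈ F, (x n / μ n) ^ 2 := by
    refine le_trans ?_ (add_le_add (mul_le_mul_of_nonneg_left h (sq_nonneg M)) le_rfl)
    rw [Finset.mul_sum, Finset.mul_sum, ← Finset.sum_add_distrib, ← Finset.sum_coe_sort F]
    refine Finset.sum_le_sum fun n _ => ?_
    have hw := waterWeight_pos hε ((hF n).1 n.2)
    have hμn := hμ n
    have hMn := hM n
    calc (x n - (0 : F → ℝ) n) ^ 2 = x n ^ 2 := by simp
      _ = μ n ^ 2 * ((x n / μ n) ^ 2 * waterWeight ε (μ n)) + ε ^ 2 * (x n / μ n) ^ 2 := by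
          unfold waterWeight
          field_simp
          ring
      _ ≤ _ := by gcongr
  have h2 : M ^ 2 * (ε ^ 2 * κ / M ^ 2) = ε ^ 2 * κ := by field_simp
  rw [h2] at h1
  have h3 : ε ^ 2 * κ + ε ^ 2 ≤ (ε * (1 + κ)) ^ 2 := by
    have : 0 ≤ ε ^ 2 * (κ + κ ^ 2) := by positivity
    nlinarith
  linarith

/-- Any finite part of the ellipsoid is covered, at a scale slightly above `ε`, by a number of
balls close to the volume ratio `∏ μₙ / ε`. -/
lemma exists_cover_of_finset {μ : ℕ+ → ℝ} (hμ : ∀ n, 0 < μ n) {ε A M : ℝ} (hε : 0 < ε)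
    (hM : ∀ n, μ n ≤ M)
    {F : Finset ℕ+} (hF : ∀ n, n ∈ F ↔ ε < μ n) (hA : ∑ n ∈ F, waterWeight ε (μ n) = A)
    (hA1 : 1 ≤ A) (T : Finset EllTwo) (hT : ∀ x ∈ T, x ∈ ellipsoid μ) :
    ∃ C : Finset EllTwo,
      (C.card : ℝ) ≤ 1 + ⌈(Real.sqrt A + 1) * Real.sqrt A * M ^ 2 / ε ^ 2⌉₊ *
        (Real.log T.card * (2 * Real.exp (11 * Real.sqrt A) * ∏ n ∈ F, μ n / ε) + 1) ∧
      ∀ x ∈ T, ∃ c ∈ C, dist x c ≤ ε * (1 + 10 / Real.sqrt A) := by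
  classical
  set q := Real.sqrt A with hq
  have hq1 : 1 ≤ q := Real.one_le_sqrt.2 hA1
  have hqA : q ^ 2 = A := Real.sq_sqrt (by linarith)
  have hM0 : 0 < M := (hμ 1).trans_le (hM 1)
  -- The energy range [0, 1] is cut into m ≥ w slices of width 1/m. Since w · sm = q + 1, a point
  -- with energy above `sm` lies in a slice of index k ≥ q. Then k + 1 ≤ k(1 + 1/q), and the slice
  -- fits the window [tA, t(A + q)] with t = k/(mA).
  set w := (q + 1) * q * M ^ 2 / ε ^ 2 with hw
  set m := ⌈w⌉₊ with hm
  have hw0 : 0 < w := by positivity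
  have hm0 : (0 : ℝ) < m := by exact_mod_cast Nat.ceil_pos.2 hw0
  have hwm : w ≤ m := Nat.le_ceil w
  set S : EllTwo → ℝ := fun x => ∑ n ∈ F, (x n / μ n) ^ 2 * waterWeight ε (μ n) with hS
  have hS1 : ∀ x ∈ ellipsoid μ, S x ≤ 1 := fun x hx => by
    refine le_trans (Finset.sum_le_sum fun n _ => ?_) (mem_ellipsoid_iff.1 hx F)
    exact mul_le_of_le_one_right (sq_nonneg _) (waterWeight_le_one _ _)
  set sm : ℝ := ε ^ 2 * (1 / q) / M ^ 2 with hsm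
  set Tk : ℕ → Finset EllTwo := fun k => T.filter fun x => sm < S x ∧ ⌊m * S x⌋₊ = k with hTk
  have hwsm : w * sm = q + 1 := by
    rw [hw, hsm]
    field_simp
  have hk : ∀ x ∈ T, sm < S x → q ≤ (⌊m * S x⌋₊ : ℝ) := by
    intro x _ h
    have h1 := Nat.lt_floor_add_one ((m : ℝ) * S x)
    have h2 : w * sm ≤ m * S x := mul_le_mul hwm h.le (by positivity) hm0.le
    linarith
  have hclass : ∀ k ∈ Finset.Icc 1 m, ∃ C : Finset EllTwo,
      (C.card : ℝ) ≤ Real.log T.card * (2 * Real.exp (11 * q) * ∏ n ∈ F, μ n / ε) + 1 ∧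
      ∀ x ∈ Tk k, ∃ c ∈ C, dist x c ≤ ε * (1 + 10 / q) := by
    intro k hk'
    obtain ⟨hk1, hkm⟩ := Finset.mem_Icc.1 hk'
    have hkpos : (0 : ℝ) < k := by exact_mod_cast hk1
    have hkm' : (k : ℝ) ≤ m := by exact_mod_cast hkm
    have htA : k / (m * A) * A = k / m := by field_simp
    obtain ⟨C, hC, hCT⟩ := exists_cover_of_energy_class hμ hε hF hA hA1
      (t := k / (m * A)) (by positivity) (by rw [htA]; exact (div_le_one hm0).2 hkm') (Tk k) (by
        intro x hx
        obtain ⟨hxT, hxs, hxk⟩ := Finset.mem_filter.1 hx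
        have hS0 : 0 < S x := lt_trans (by positivity) hxs
        refine ⟨hT x hxT, ?_, ?_⟩
        · rw [htA, div_le_iff₀ hm0, mul_comm, ← hxk]
          exact Nat.floor_le (by positivity)
        · have h1 := Nat.lt_floor_add_one ((m : ℝ) * S x)
          have h2 := hk x hxT hxs
          rw [hxk] at h1 h2
          have h3 : k / (m * A) * (A + q) = (k + k / q) / m := by
            rw [← hqA]
            field_simp
          change S x ≤ k / (m * A) * (A + q)
          rw [h3, le_div_iff₀ hm0]
          have : 1 ≤ k / q := (one_le_div (by positivity)).2 h2
          linarith)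
    refine ⟨C, hC.trans ?_, hCT⟩
    have hle : Real.log (Tk k).card ≤ Real.log T.card := by
      rcases (Tk k).eq_empty_or_nonempty with h | h
      · rw [h]
        simpa using Real.log_natCast_nonneg _
      · refine Real.log_le_log (by exact_mod_cast h.card_pos) ?_
        exact_mod_cast Finset.card_le_card (Finset.filter_subset _ _)
    have hprod : (∏ n ∈ F, ε / μ n)⁻¹ = ∏ n ∈ F, μ n / ε := by
      rw [← Finset.prod_inv_distrib]
      exact Finset.prod_congr rfl fun n _ => inv_div _ _
    have hP : 0 < ∏ n ∈ F, μ n / ε := Finset.prod_pos fun n _ => div_pos (hμ n) hε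
    have heq : Real.log (Tk k).card / ((∏ n ∈ F, ε / μ n) * Real.exp (-(11 * q)) / 2) =
        Real.log (Tk k).card * (2 * Real.exp (11 * q) * ∏ n ∈ F, μ n / ε) := by
      rw [← hprod, Real.exp_neg, div_eq_mul_inv]
      congr 1
      rw [div_eq_mul_inv, mul_inv, mul_inv, inv_inv, inv_inv]
      ring
    rw [heq]
    gcongr
  choose! Ck hCk hCkT using hclass
  refine ⟨insert 0 ((Finset.Icc 1 m).biUnion Ck), ?_, ?_⟩
  · calc ((insert 0 ((Finset.Icc 1 m).biUnion Ck)).card : ℝ)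
        ≤ ((∑ k ∈ Finset.Icc 1 m, (Ck k).card + 1 : ℕ) : ℝ) := by
          exact_mod_cast (Finset.card_insert_le _ _).trans
            (Nat.add_le_add_right Finset.card_biUnion_le 1)
      _ = 1 + ∑ k ∈ Finset.Icc 1 m, ((Ck k).card : ℝ) := by push_cast; ring
      _ ≤ 1 + ∑ k ∈ Finset.Icc 1 m,
            (Real.log T.card * (2 * Real.exp (11 * q) * ∏ n ∈ F, μ n / ε) + 1) := by
          gcongr with k hk'
          exact hCk k hk'
      _ = _ := by rw [Finset.sum_const, Nat.card_Icc, nsmul_eq_mul, Nat.add_sub_cancel]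
  · intro x hx
    by_cases hxs : sm < S x
    · set k := ⌊m * S x⌋₊ with hkdef
      have hkI : k ∈ Finset.Icc 1 m := by
        refine Finset.mem_Icc.2 ⟨?_, ?_⟩
        · have := hq1.trans (hk x hx hxs)
          exact_mod_cast this
        · refine Nat.floor_le_of_le ?_
          exact mul_le_of_le_one_right hm0.le (hS1 x (hT x hx))
      obtain ⟨c, hc, hd⟩ := hCkT k hkI x (Finset.mem_filter.2 ⟨hx, hxs, rfl⟩)
      exact ⟨c, Finset.mem_insert_of_mem (Finset.mem_biUnion.2 ⟨k, hkI, hc⟩), hd⟩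
    · refine ⟨0, Finset.mem_insert_self _ _, ?_⟩
      refine (dist_zero_le_of_energy_le hμ hε hM (κ := 1 / q) (by positivity) hF (hT x hx)
        (not_lt.1 hxs)).trans ?_
      gcongr
      norm_num

/-- One point is kept per fibre of `f`. The representatives stay in `K`, as needed for a net lying
inside the ellipsoid. -/
lemma exists_finset_representatives {X Y : Type*} (f : X → Y) (K : Set X) (B : Finset Y)
    (h : ∀ x ∈ K, f x ∈ B) :
    ∃ T : Finset X, T.card ≤ B.card ∧ (∀ x ∈ T, x ∈ K) ∧ ∀ x ∈ K, ∃ y ∈ T, f x = f y := by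
  classical
  obtain ⟨K', hK', hbij⟩ := (Set.surjOn_image f K).exists_bijOn_subset
  have hmaps : ∀ x ∈ K', f x ∈ B := fun x hx => h x (hK' hx)
  have hfin : K'.Finite := Set.Finite.of_finite_image
    (B.finite_toSet.subset (by rintro _ ⟨x, hx, rfl⟩; exact hmaps x hx)) hbij.injOn
  refine ⟨hfin.toFinset, Finset.card_le_card_of_injOn f (fun x hx => ?_) ?_, ?_, ?_⟩
  · exact hmaps x (by simpa using hx)
  · simpa using hbij.injOn
  · exact fun x hx => hK' (by simpa using hx)
  · intro x hx
    obtain ⟨y, hy, hxy⟩ := hbij.surjOn (Set.mem_image_of_mem f hx)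
    exact ⟨y, by simpa using hy, hxy.symm⟩

/-- A crude net of the ellipsoid, from a grid on finitely many coordinates. -/
lemma exists_net_ellipsoid {μ : ℕ+ → ℝ} (hμ : ∀ n, 0 < μ n) {r M : ℝ} (hr : 0 < r)
    (hM : ∀ n, μ n ≤ M) (F : Finset ℕ+) (hF : ∀ n ∉ F, μ n ≤ r / 4) :
    ∃ T : Finset EllTwo, (∀ x ∈ T, x ∈ ellipsoid μ) ∧
      (∀ x ∈ ellipsoid μ, ∃ y ∈ T, dist x y ≤ r) ∧
      Real.log T.card ≤ F.card * (4 * M * (F.card + 1) / r + 1) := by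
  classical
  have hM0 : 0 < M := (hμ 1).trans_le (hM 1)
  -- Points in the same grid cell differ by less than h on each axis of `F`, so by at most r²/4 in
  -- total square there; the tails contribute another r²/4.
  set h : ℝ := r / (2 * (F.card + 1)) with hh
  have hh0 : 0 < h := by positivity
  set I : Finset ℤ := Finset.Icc ⌊-(M / h)⌋ ⌊M / h⌋ with hI
  have hxM : ∀ x ∈ ellipsoid μ, ∀ n, |x n| ≤ M := by
    intro x hx n
    have h1 := mem_ellipsoid_iff.1 hx {n}
    rw [Finset.sum_singleton, div_pow, div_le_one (pow_pos (hμ n) 2)] at h1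
    exact (abs_le_of_sq_le_sq h1 (hμ n).le).trans (hM n)
  obtain ⟨T, hTcard, hTE, hT⟩ := exists_finset_representatives
    (fun (x : EllTwo) (n : F) => ⌊x n / h⌋) (ellipsoid μ) (Fintype.piFinset fun _ => I) (by
      intro x hx
      refine Fintype.mem_piFinset.2 fun n => Finset.mem_Icc.2 ?_
      have h1 := abs_le.1 (hxM x hx n)
      refine ⟨Int.floor_mono ?_, Int.floor_mono ?_⟩
      · rw [← neg_div]
        gcongr
        exact h1.1
      · gcongr
        exact h1.2)
  refine ⟨T, hTE, fun x hx => ?_, ?_⟩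
  · obtain ⟨y, hy, hxy⟩ := hT x hx
    have hyE := hTE y hy
    refine ⟨y, hy, ?_⟩
    rw [dist_eq_norm]
    refine EllTwo.norm_le_of_sum_sq_le hr.le fun s => ?_
    refine (sum_le_sum_add_sum_sdiff (F := F) fun n => sq_nonneg _).trans ?_
    have h1 : ∑ n ∈ F, (x - y) n ^ 2 ≤ r ^ 2 / 4 := by
      calc ∑ n ∈ F, (x - y) n ^ 2 ≤ ∑ n ∈ F, h ^ 2 := by
            refine Finset.sum_le_sum fun n hn => ?_
            have h2 : ⌊x n / h⌋ = ⌊y n / h⌋ := congrFun hxy ⟨n, hn⟩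
            have h3 := Int.abs_sub_lt_one_of_floor_eq_floor h2
            rw [← sub_div, abs_div, abs_of_pos hh0, div_lt_one hh0] at h3
            rw [lp.coeFn_sub, Pi.sub_apply]
            exact sq_le_sq' (by linarith [(abs_lt.1 h3).1]) (abs_lt.1 h3).2.le
        _ = F.card * h ^ 2 := by rw [Finset.sum_const, nsmul_eq_mul]
        _ = (F.card / (F.card + 1) ^ 2) * (r ^ 2 / 4) := by
            rw [hh]
            field_simp
            norm_num
        _ ≤ 1 * (r ^ 2 / 4) := by
            gcongr
            rw [div_le_one (by positivity)]
            have : (0 : ℝ) ≤ F.card := by positivity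
            nlinarith
        _ = _ := one_mul _
    have h2 : ∑ n ∈ s \ F, (x - y) n ^ 2 ≤ r ^ 2 / 4 := by
      have hU : ∀ z : EllTwo, 0 ≤ ∑ n ∈ F, (z n / μ n) ^ 2 := fun z =>
        Finset.sum_nonneg fun n _ => sq_nonneg _
      have hz : ∀ z ∈ ellipsoid μ, ∑ n ∈ s \ F, z n ^ 2 ≤ (r / 4) ^ 2 := fun z hz => by
        refine (sum_sq_le_of_mem_ellipsoid hμ hz hF).trans ?_
        exact mul_le_of_le_one_right (sq_nonneg _) (by linarith [hU z])
      calc ∑ n ∈ s \ F, (x - y) n ^ 2 ≤ ∑ n ∈ s \ F, (2 * x n ^ 2 + 2 * y n ^ 2) := by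
            refine Finset.sum_le_sum fun n _ => ?_
            rw [lp.coeFn_sub, Pi.sub_apply]
            nlinarith [sq_nonneg (x n + y n)]
        _ = 2 * ∑ n ∈ s \ F, x n ^ 2 + 2 * ∑ n ∈ s \ F, y n ^ 2 := by
            rw [Finset.sum_add_distrib, Finset.mul_sum, Finset.mul_sum]
        _ ≤ 2 * (r / 4) ^ 2 + 2 * (r / 4) ^ 2 := by
            gcongr
            · exact hz x hx
            · exact hz y hyE
        _ = r ^ 2 / 4 := by ring
    nlinarith [sq_nonneg r]
  · have hIcard : (I.card : ℝ) ≤ 2 * (M / h) + 2 := by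
      have h1 : (I.card : ℝ) = ((⌊M / h⌋ + 1 - ⌊-(M / h)⌋ : ℤ) : ℝ) := by
        have h0 : ⌊-(M / h)⌋ ≤ ⌊M / h⌋ := Int.floor_mono (by
          have : 0 < M / h := by positivity
          linarith)
        rw [hI, Int.card_Icc, ← Int.cast_natCast, Int.toNat_of_nonneg (by omega)]
      rw [h1]
      push_cast
      linarith [Int.floor_le (M / h), Int.lt_floor_add_one (-(M / h))]
    rcases T.card.eq_zero_or_pos with h0 | hpos
    · rw [h0]
      simp only [Nat.cast_zero, Real.log_zero]
      positivity
    have hTc : (T.card : ℝ) ≤ (2 * (M / h) + 2) ^ F.card := by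
      calc (T.card : ℝ) ≤ ((Fintype.piFinset fun _ : F => I).card : ℝ) := by exact_mod_cast hTcard
        _ = (I.card : ℝ) ^ F.card := by
            rw [Fintype.card_piFinset]
            simp
        _ ≤ _ := by gcongr
    calc Real.log T.card ≤ Real.log ((2 * (M / h) + 2) ^ F.card) :=
          Real.log_le_log (by exact_mod_cast hpos) hTc
      _ = F.card * Real.log (2 * (M / h) + 2) := Real.log_pow _ _
      _ ≤ F.card * (4 * M * (F.card + 1) / r + 1) := by
          gcongr
          have h1 : 0 < 2 * (M / h) + 2 := by positivity
          refine (Real.log_le_sub_one_of_pos h1).trans (le_of_eq ?_)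
          rw [hh]
          field_simp
          ring

end Cover

/-! ### Volume lower bound. -/

section Volume

open MeasureTheory

/-- Constant axes ε give the balls of a cover, so the unit-ball volume cancels in the comparison and
never has to be computed. -/
lemma volume_pi_ellipsoid {ι : Type*} [Fintype ι] [DecidableEq ι] (μ : ι → ℝ) (hμ : ∀ i, 0 < μ i)
    (c : ι → ℝ) :
    volume {y : ι → ℝ | ∑ i, ((y i - c i) / μ i) ^ 2 ≤ 1} =
      ENNReal.ofReal (∏ i, μ i) * volume {y : ι → ℝ | ∑ i, y i ^ 2 ≤ 1} := by
  have h1 : {y : ι → ℝ | ∑ i, ((y i - c i) / μ i) ^ 2 ≤ 1} =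
      (fun y => y + -c) ⁻¹' {y : ι → ℝ | ∑ i, (y i / μ i) ^ 2 ≤ 1} := by
    simp [Set.preimage, sub_eq_add_neg]
  have h2 : {y : ι → ℝ | ∑ i, (y i / μ i) ^ 2 ≤ 1} =
      Matrix.toLin' (Matrix.diagonal fun i => (μ i)⁻¹) ⁻¹' {y : ι → ℝ | ∑ i, y i ^ 2 ≤ 1} := by
    ext y
    simp only [Set.mem_preimage, Set.mem_ofPred_eq, Matrix.toLin'_apply, Matrix.mulVec_diagonal]
    simp only [div_eq_inv_mul]
  have hprod : 0 < ∏ i, μ i := Finset.prod_pos fun i _ => hμ i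
  have hdet : LinearMap.det (Matrix.toLin' (Matrix.diagonal fun i => (μ i)⁻¹)) =
      (∏ i, μ i)⁻¹ := by
    rw [LinearMap.det_toLin', Matrix.det_diagonal, Finset.prod_inv_distrib]
  rw [h1, measure_preimage_add_right, h2,
    Measure.addHaar_preimage_linearMap _ (by rw [hdet]; positivity), hdet, inv_inv,
    abs_of_pos hprod]

lemma volume_pi_unitBall_ne_zero {ι : Type*} [Fintype ι] :
    volume {y : ι → ℝ | ∑ i, y i ^ 2 ≤ 1} ≠ 0 := by
  have hopen : IsOpen {y : ι → ℝ | ∑ i, y i ^ 2 < 1} :=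
    isOpen_lt (by fun_prop) continuous_const
  have h := hopen.measure_pos volume ⟨0, by simp⟩
  refine (h.trans_le (measure_mono fun y hy => ?_)).ne'
  exact le_of_lt (show ∑ i, y i ^ 2 < 1 from hy)

lemma volume_pi_unitBall_ne_top {ι : Type*} [Fintype ι] :
    volume {y : ι → ℝ | ∑ i, y i ^ 2 ≤ 1} ≠ ⊤ := by
  refine ((measure_mono ?_).trans_lt (measure_closedBall_lt_top (x := (0 : ι → ℝ)) (r := 1))).ne
  intro y hy
  rw [mem_closedBall_zero_iff, pi_norm_le_iff_of_nonneg zero_le_one]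
  intro i
  have h1 : y i ^ 2 ≤ 1 :=
    (Finset.single_le_sum (f := fun i => y i ^ 2) (fun j _ => sq_nonneg _)
      (Finset.mem_univ i)).trans hy
  rw [Real.norm_eq_abs]
  exact (sq_le_one_iff_abs_le_one _).1 h1

/-- Volume lower bound for the size of a cover of the ellipsoid. -/
lemma prod_le_card_of_cover {μ : ℕ+ → ℝ} (hμ : ∀ n, 0 < μ n) {ε : ℝ} (hε : 0 < ε)
    (C : Finset EllTwo) (hC : ∀ x ∈ ellipsoid μ, ∃ c ∈ C, dist x c ≤ ε) (F : Finset ℕ+) :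
    ∏ n ∈ F, μ n / ε ≤ C.card := by
  set V := volume {y : F → ℝ | ∑ i, y i ^ 2 ≤ 1} with hV
  have hsub : {y : F → ℝ | ∑ i, ((y i - (0 : F → ℝ) i) / μ i) ^ 2 ≤ 1} ⊆
      ⋃ c ∈ C, {y : F → ℝ | ∑ i, ((y i - c i) / ε) ^ 2 ≤ 1} := by
    intro y hy
    have hyE : EllTwo.extend F y ∈ ellipsoid μ := by
      refine mem_ellipsoid_iff.2 fun s => ?_
      refine (sum_le_sum_add_sum_sdiff (F := F) fun n => sq_nonneg _).trans ?_
      have h1 : ∑ n ∈ s \ F, (EllTwo.extend F y n / μ n) ^ 2 = 0 :=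
        Finset.sum_eq_zero fun n hn => by
          rw [EllTwo.extend_apply_of_notMem F y (Finset.mem_sdiff.1 hn).2]
          simp
      rw [h1, add_zero, ← Finset.sum_coe_sort F]
      refine le_trans (le_of_eq (Finset.sum_congr rfl fun n _ => ?_)) hy
      rw [EllTwo.extend_apply_coe]
      simp
    obtain ⟨c, hc, hd⟩ := hC _ hyE
    refine Set.mem_biUnion hc ?_
    change ∑ i : F, ((y i - c i) / ε) ^ 2 ≤ 1
    have h2 := EllTwo.sum_sq_le (EllTwo.extend F y - c) F
    rw [dist_eq_norm] at hd
    have h3 : ‖EllTwo.extend F y - c‖ ^ 2 ≤ ε ^ 2 := pow_le_pow_left₀ (norm_nonneg _) hd 2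
    rw [← Finset.sum_coe_sort F] at h2
    calc ∑ i : F, ((y i - c i) / ε) ^ 2 = (∑ i : F, (EllTwo.extend F y - c) i ^ 2) / ε ^ 2 := by
          rw [Finset.sum_div]
          refine Finset.sum_congr rfl fun i _ => ?_
          rw [lp.coeFn_sub, Pi.sub_apply, EllTwo.extend_apply_coe, div_pow]
      _ ≤ 1 := by
          rw [div_le_one (by positivity)]
          exact h2.trans h3
  have hvol := (measure_mono hsub).trans (measure_biUnion_finset_le (μ := volume) C _)
  classical
  rw [volume_pi_ellipsoid (fun i : F => μ i) (fun i => hμ i)] at hvol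
  simp_rw [fun c : EllTwo => volume_pi_ellipsoid (fun _ : F => ε) (fun _ => hε) (fun i => c i)]
    at hvol
  rw [Finset.sum_const, nsmul_eq_mul, ← mul_assoc, Finset.prod_coe_sort F μ,
    ENNReal.mul_le_mul_iff_left volume_pi_unitBall_ne_zero volume_pi_unitBall_ne_top,
    ← ENNReal.ofReal_natCast, ← ENNReal.ofReal_mul (by positivity),
    ENNReal.ofReal_le_ofReal_iff (by positivity)] at hvol
  rw [Finset.prod_div_distrib, div_le_iff₀ (by positivity)]
  refine hvol.trans (le_of_eq ?_)
  simp

end Volume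

/-! ### Covering numbers and finite covers. -/

section CoveringNumber

variable {X : Type*} [PseudoMetricSpace X]

lemma isCover_toNNReal_iff {ε : ℝ} (hε : 0 < ε) {K C : Set X} :
    Metric.IsCover ε.toNNReal K C ↔ ∀ x ∈ K, ∃ c ∈ C, dist x c ≤ ε := by
  rw [Metric.isCover_iff_subset_iUnion_closedBall, Real.coe_toNNReal _ hε.le]
  simp [Set.subset_def]

lemma coveringNum_le_card {ε : ℝ} (hε : 0 < ε) {K : Set X} (C : Finset X)
    (hC : ∀ x ∈ K, ∃ c ∈ C, dist x c ≤ ε) : coveringNum ε K ≤ C.card := by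
  have h : Metric.IsCover ε.toNNReal K (C : Set X) := (isCover_toNNReal_iff hε).2 hC
  have h1 := h.externalCoveringNumber_le_encard
  rwa [Set.encard_coe_eq_coe_finsetCard] at h1

lemma toNat_coveringNum_le_card {ε : ℝ} (hε : 0 < ε) {K : Set X} (C : Finset X)
    (hC : ∀ x ∈ K, ∃ c ∈ C, dist x c ≤ ε) : (coveringNum ε K).toNat ≤ C.card :=
  ENat.toNat_le_of_le_natCast (coveringNum_le_card hε C hC)

lemma exists_finset_card_eq_coveringNum {ε : ℝ} (hε : 0 < ε) {K : Set X}
    (h : coveringNum ε K ≠ ⊤) :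
    ∃ C : Finset X, (∀ x ∈ K, ∃ c ∈ C, dist x c ≤ ε) ∧ C.card = (coveringNum ε K).toNat := by
  have hne : Nonempty {C : Set X // Metric.IsCover ε.toNNReal K C} := ⟨K, Metric.IsCover.rfl⟩
  have h1 : coveringNum ε K = ⨅ C : {C : Set X // Metric.IsCover ε.toNNReal K C}, C.1.encard := by
    rw [iInf_subtype]
    rfl
  obtain ⟨⟨C, hC⟩, hCe⟩ := ENat.exists_eq_iInf
    (fun C : {C : Set X // Metric.IsCover ε.toNNReal K C} => C.1.encard)
  rw [← h1] at hCe
  have hfin : C.Finite := Set.encard_ne_top_iff.1 (by rw [hCe]; exact h)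
  refine ⟨hfin.toFinset, ?_, ?_⟩
  · simpa using (isCover_toNNReal_iff hε).1 hC
  · rw [← hCe, hfin.encard_eq_coe_toFinset_card, ENat.toNat_natCast]

end CoveringNumber

/-! ### Non-asymptotic entropy bounds. -/

section EntropyBounds

lemma coveringNum_ellipsoid_ne_top {μ : ℕ+ → ℝ} (hμ : ∀ n, 0 < μ n) (hanti : Antitone μ)
    (hlim : Tendsto μ atTop (𝓝 0)) {ε : ℝ} (hε : 0 < ε) : coveringNum ε (ellipsoid μ) ≠ ⊤ := by
  obtain ⟨N, hN⟩ := (hlim.eventually (gt_mem_nhds (show 0 < ε / 4 by positivity))).exists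
  obtain ⟨T, -, hT, -⟩ := exists_net_ellipsoid hμ hε (fun n => hanti (one_le))
    (Finset.Iic N) (fun n hn => (hanti (le_of_lt (by simpa using hn))).trans hN.le)
  exact ne_top_of_le_ne_top (ENat.natCast_ne_top _) (coveringNum_le_card hε T hT)

lemma sum_log_le_log_coveringNum {μ : ℕ+ → ℝ} (hμ : ∀ n, 0 < μ n) {ε : ℝ} (hε : 0 < ε)
    (h : coveringNum ε (ellipsoid μ) ≠ ⊤) (F : Finset ℕ+) :
    ∑ n ∈ F, Real.log (μ n / ε) ≤ Real.log (coveringNum ε (ellipsoid μ)).toNat := by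
  obtain ⟨C, hC, hcard⟩ := exists_finset_card_eq_coveringNum hε h
  rw [← Real.log_prod fun n _ => (div_pos (hμ n) hε).ne', ← hcard]
  exact Real.log_le_log (Finset.prod_pos fun n _ => div_pos (hμ n) hε)
    (prod_le_card_of_cover hμ hε C hC F)

/-- An r-net of the ellipsoid is covered by the random codebook, and r is added to the radius. The
four terms come from the volume ratio, the loss in the hitting probability, the number of energy
classes and the logarithm of the net's size. The latter sits inside a further logarithm, so a crude
net suffices. -/
lemma log_coveringNum_le {μ : ℕ+ → ℝ} (hμ : ∀ n, 0 < μ n) {ε ρ r A M : ℝ} (hε : 0 < ε)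
    (hr : 0 < r) (hM : ∀ n, μ n ≤ M) {F G : Finset ℕ+} (hF : ∀ n, n ∈ F ↔ ε < μ n)
    (hA : ∑ n ∈ F, waterWeight ε (μ n) = A) (hA1 : 1 ≤ A) (hG : ∀ n ∉ G, μ n ≤ r / 4)
    (hρ : ε * (1 + 10 / Real.sqrt A) + r ≤ ρ) :
    Real.log (coveringNum ρ (ellipsoid μ)).toNat ≤
      ∑ n ∈ F, Real.log (μ n / ε) + 11 * Real.sqrt A +
        Real.log (1 + ⌈(Real.sqrt A + 1) * Real.sqrt A * M ^ 2 / ε ^ 2⌉₊) +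
        Real.log (2 * (G.card * (4 * M * (G.card + 1) / r + 1)) + 1) := by
  have hM0 : 0 < M := (hμ 1).trans_le (hM 1)
  obtain ⟨T, hTE, hT, hTlog⟩ := exists_net_ellipsoid hμ hr hM G hG
  obtain ⟨C, hC, hCT⟩ := exists_cover_of_finset hμ hε hM hF hA hA1 T hTE
  have hρ0 : 0 < ρ := lt_of_lt_of_le (by positivity) hρ
  have hcov : ∀ x ∈ ellipsoid μ, ∃ c ∈ C, dist x c ≤ ρ := by
    intro x hx
    obtain ⟨y, hy, hxy⟩ := hT x hx
    obtain ⟨c, hc, hyc⟩ := hCT y hy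
    exact ⟨c, hc, by linarith [dist_triangle x y c]⟩
  have hcard : ((coveringNum ρ (ellipsoid μ)).toNat : ℝ) ≤ C.card := by
    exact_mod_cast toNat_coveringNum_le_card hρ0 C hcov
  set m : ℝ := (⌈(Real.sqrt A + 1) * Real.sqrt A * M ^ 2 / ε ^ 2⌉₊ : ℝ) with hm
  have hm0 : 0 ≤ m := Nat.cast_nonneg _
  set ℓ : ℝ := G.card * (4 * M * (G.card + 1) / r + 1) with hℓ
  have hℓ0 : 0 ≤ ℓ := by positivity
  set P : ℝ := ∏ n ∈ F, μ n / ε with hP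
  have hP1 : 1 ≤ P :=
    Finset.one_le_prod fun n hn => (one_le_div hε).2 ((hF n).1 hn).le
  have hP0 : 0 < P := by linarith
  have he1 : 1 ≤ Real.exp (11 * Real.sqrt A) := Real.one_le_exp (by positivity)
  have hX : (C.card : ℝ) ≤ (P * Real.exp (11 * Real.sqrt A)) * (1 + m) * (2 * ℓ + 1) := by
    refine hC.trans ?_
    set e := Real.exp (11 * Real.sqrt A)
    have h1 : Real.log T.card * (2 * e * P) ≤ ℓ * (2 * e * P) := by gcongr
    have hY : 1 ≤ P * e := by nlinarith
    have h2 : m * (Real.log T.card * (2 * e * P) + 1) ≤ m * (ℓ * (2 * e * P) + P * e) := by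
      gcongr
    have h3 : 0 ≤ P * e * (2 * ℓ) := by positivity
    nlinarith
  rcases Nat.eq_zero_or_pos (coveringNum ρ (ellipsoid μ)).toNat with h0 | hpos
  -- With the convention log 0 = 0, it is enough that the right side is nonnegative.
  · rw [h0, Nat.cast_zero, Real.log_zero]
    have h1 : 0 ≤ ∑ n ∈ F, Real.log (μ n / ε) := Finset.sum_nonneg fun n hn =>
      Real.log_nonneg ((one_le_div hε).2 ((hF n).1 hn).le)
    have h2 : 0 ≤ Real.log (1 + m) := Real.log_nonneg (by linarith)
    have h3 : 0 ≤ Real.log (2 * ℓ + 1) := Real.log_nonneg (by linarith)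
    positivity
  · refine (Real.log_le_log (by exact_mod_cast hpos) (hcard.trans hX)).trans (le_of_eq ?_)
    rw [Real.log_mul (by positivity) (by positivity), Real.log_mul (by positivity) (by positivity),
      Real.log_mul (by positivity) (by positivity), Real.log_exp, hP,
      Real.log_prod fun n _ => (div_pos (hμ n) hε).ne']

end EntropyBounds

/-! ### Asymptotics of sums of logarithms of the semi-axes. -/

section SequenceAsymptotics

lemma isLittleO_log_natCast_rpow {p : ℝ} (hp : 0 < p) :
    (fun n : ℕ => Real.log n) =o[atTop] fun n : ℕ => (n : ℝ) ^ p :=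
  (isLittleO_log_rpow_atTop hp).comp_tendsto tendsto_natCast_atTop_atTop

lemma tendsto_natCast_rpow_atTop {p : ℝ} (hp : 0 < p) :
    Tendsto (fun n : ℕ => (n : ℝ) ^ p) atTop atTop :=
  (tendsto_rpow_atTop hp).comp tendsto_natCast_atTop_atTop

lemma isLittleO_const_natCast_rpow {p : ℝ} (hp : 0 < p) (C : ℝ) :
    (fun _ : ℕ => C) =o[atTop] fun n : ℕ => (n : ℝ) ^ p :=
  isLittleO_const_left.2 (Or.inr (tendsto_norm_atTop_atTop.comp (tendsto_natCast_rpow_atTop hp)))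

lemma log_factorial_sub_isLittleO {p : ℝ} (hp : 0 < p) :
    (fun n : ℕ => Real.log n.factorial - (n * Real.log n - n)) =o[atTop]
      fun n : ℕ => (n : ℝ) ^ p := by
  have h1 : Tendsto (fun n : ℕ => Real.log (Stirling.stirlingSeq n)) atTop
      (𝓝 (Real.log (Real.sqrt Real.pi))) :=
    Stirling.tendsto_stirlingSeq_sqrt_pi.log (by positivity)
  have h2 : (fun n : ℕ => Real.log (Stirling.stirlingSeq n)) =o[atTop] fun n : ℕ => (n : ℝ) ^ p :=
    (h1.isBigO_one ℝ).trans_isLittleO (isLittleO_const_natCast_rpow hp 1)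
  have h3 := (h2.add (isLittleO_const_natCast_rpow hp (1 / 2 * Real.log 2))).add
    ((isLittleO_log_natCast_rpow hp).const_mul_left (1 / 2))
  refine h3.congr' ?_ EventuallyEq.rfl
  filter_upwards [eventually_gt_atTop 0] with n hn
  have hn' : (0 : ℝ) < n := by exact_mod_cast hn
  rw [Stirling.log_stirlingSeq_formula, Real.log_mul (by norm_num) hn'.ne',
    Real.log_div hn'.ne' (Real.exp_pos 1).ne', Real.log_exp]
  ring

/-- Bernoulli's inequality for exponents in (0, 1), at -1/(k+1). With `rpow_succ_sub_rpow_le` it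
makes the power sums comparable to telescoping sums. -/
lemma rpow_sub_rpow_le {p : ℝ} (hp0 : 0 < p) (hp1 : p < 1) (k : ℕ) :
    p * ((k : ℝ) + 1) ^ (p - 1) ≤ ((k : ℝ) + 1) ^ p - (k : ℝ) ^ p := by
  have hk : (0 : ℝ) < (k : ℝ) + 1 := by positivity
  have h := rpow_one_add_le_one_add_mul_self (s := -((k : ℝ) + 1)⁻¹) (p := p)
    (by
      have : ((k : ℝ) + 1)⁻¹ ≤ 1 := inv_le_one_of_one_le₀ (by linarith [Nat.cast_nonneg (α := ℝ) k])
      linarith) hp0.le hp1.le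
  have h1 : (1 + -((k : ℝ) + 1)⁻¹) = k / (k + 1) := by
    field_simp
    ring
  rw [h1, Real.div_rpow (Nat.cast_nonneg _) hk.le, div_le_iff₀ (by positivity)] at h
  rw [Real.rpow_sub_one hk.ne']
  have : (1 + p * -((k : ℝ) + 1)⁻¹) * ((k : ℝ) + 1) ^ p =
      ((k : ℝ) + 1) ^ p - p * (((k : ℝ) + 1) ^ p / (k + 1)) := by
    field_simp
    ring
  linarith

lemma rpow_succ_sub_rpow_le {p : ℝ} (hp0 : 0 < p) (hp1 : p < 1) (k : ℕ) :
    ((k : ℝ) + 2) ^ p - ((k : ℝ) + 1) ^ p ≤ p * ((k : ℝ) + 1) ^ (p - 1) := by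
  have hk : (0 : ℝ) < (k : ℝ) + 1 := by positivity
  have h := rpow_one_add_le_one_add_mul_self (s := ((k : ℝ) + 1)⁻¹) (p := p)
    (by
      have : 0 < ((k : ℝ) + 1)⁻¹ := by positivity
      linarith) hp0.le hp1.le
  have h1 : (1 + ((k : ℝ) + 1)⁻¹) = (k + 2) / (k + 1) := by
    field_simp
    ring
  rw [h1, Real.div_rpow (by positivity) hk.le, div_le_iff₀ (by positivity)] at h
  rw [Real.rpow_sub_one hk.ne']
  have : (1 + p * ((k : ℝ) + 1)⁻¹) * ((k : ℝ) + 1) ^ p =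
      ((k : ℝ) + 1) ^ p + p * (((k : ℝ) + 1) ^ p / (k + 1)) := by
    field_simp
  linarith

lemma sum_rpow_le {p : ℝ} (hp0 : 0 < p) (hp1 : p < 1) (n : ℕ) :
    p * ∑ k ∈ Finset.range n, ((k : ℝ) + 1) ^ (p - 1) ≤ (n : ℝ) ^ p := by
  have h : ∑ k ∈ Finset.range n, (((k + 1 : ℕ) : ℝ) ^ p - (k : ℝ) ^ p) = (n : ℝ) ^ p := by
    rw [Finset.sum_range_sub (fun k : ℕ => (k : ℝ) ^ p)]
    simp [Real.zero_rpow hp0.ne']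
  rw [← h, Finset.mul_sum]
  refine Finset.sum_le_sum fun k _ => ?_
  push_cast
  exact rpow_sub_rpow_le hp0 hp1 k

lemma le_sum_rpow {p : ℝ} (hp0 : 0 < p) (hp1 : p < 1) (n : ℕ) :
    (n : ℝ) ^ p - 1 ≤ p * ∑ k ∈ Finset.range n, ((k : ℝ) + 1) ^ (p - 1) := by
  have h : ∑ k ∈ Finset.range n, ((((k + 1 : ℕ) : ℝ) + 1) ^ p - ((k : ℝ) + 1) ^ p) =
      ((n : ℝ) + 1) ^ p - 1 := by
    rw [Finset.sum_range_sub (fun k : ℕ => ((k : ℝ) + 1) ^ p)]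
    simp
  have h1 : (n : ℝ) ^ p ≤ ((n : ℝ) + 1) ^ p :=
    Real.rpow_le_rpow (Nat.cast_nonneg _) (by linarith) hp0.le
  refine (sub_le_sub_right h1 1).trans ?_
  rw [← h, Finset.mul_sum]
  refine Finset.sum_le_sum fun k _ => ?_
  push_cast
  rw [show (k : ℝ) + 1 + 1 = k + 2 by ring]
  exact rpow_succ_sub_rpow_le hp0 hp1 k

lemma sum_rpow_sub_isLittleO {p : ℝ} (hp0 : 0 < p) (hp1 : p < 1) :
    (fun n : ℕ => ∑ k ∈ Finset.range n, ((k : ℝ) + 1) ^ (p - 1) - (n : ℝ) ^ p / p) =o[atTop]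
      fun n : ℕ => (n : ℝ) ^ p := by
  refine IsBigO.trans_isLittleO (g := fun _ : ℕ => 1 / p) ?_ (isLittleO_const_natCast_rpow hp0 _)
  refine IsBigO.of_bound 1 (Eventually.of_forall fun n => ?_)
  have h1 := sum_rpow_le hp0 hp1 n
  have h2 := le_sum_rpow hp0 hp1 n
  set s := ∑ k ∈ Finset.range n, ((k : ℝ) + 1) ^ (p - 1)
  have h3 : s - (n : ℝ) ^ p / p = (p * s - (n : ℝ) ^ p) / p := by field_simp
  rw [one_mul, h3, norm_div, norm_div]
  gcongr
  rw [Real.norm_eq_abs, norm_one, abs_le]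
  constructor <;> linarith

lemma log_one_add_sub_isLittleO {y : ℕ → ℝ} (hy : Tendsto y atTop (𝓝 0)) :
    (fun k => Real.log (1 + y k) - y k) =o[atTop] y := by
  have h := (hasDerivAt_iff_isLittleO.1 (Real.hasDerivAt_log one_ne_zero))
  have h2 : Tendsto (fun k => 1 + y k) atTop (𝓝 1) := by
    simpa using hy.const_add 1
  have h3 := h.comp_tendsto h2
  simpa [Function.comp_def] using h3

/-- A sequence with a two-term power expansion `c₁ / n ^ α₁ + c₂ / n ^ α₂`, in relative form. -/
lemma relative_expansion {α₁ α₂ c₁ c₂ : ℝ} (hc₁ : 0 < c₁) {ν : ℕ → ℝ}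
    (hν : (fun k : ℕ => ν k - (c₁ / ((k : ℝ) + 1) ^ α₁ + c₂ / ((k : ℝ) + 1) ^ α₂)) =o[atTop]
      fun k : ℕ => 1 / ((k : ℝ) + 1) ^ α₂) :
    (fun k : ℕ => (ν k * ((k : ℝ) + 1) ^ α₁ / c₁ - 1) - c₂ / c₁ * ((k : ℝ) + 1) ^ (α₁ - α₂))
      =o[atTop] fun k : ℕ => ((k : ℝ) + 1) ^ (α₁ - α₂) := by
  have h := hν.mul_isBigO (isBigO_refl (fun k : ℕ => ((k : ℝ) + 1) ^ α₁ / c₁) atTop)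
  refine (h.congr_left fun k => ?_).trans_isBigO ?_
  · have hk : (0 : ℝ) < (k : ℝ) + 1 := by positivity
    have := Real.rpow_pos_of_pos hk α₁
    have := Real.rpow_pos_of_pos hk α₂
    rw [Real.rpow_sub hk]
    field_simp
    ring
  · refine IsBigO.of_bound (1 / c₁) (Eventually.of_forall fun k => ?_)
    have hk : (0 : ℝ) < (k : ℝ) + 1 := by positivity
    have h1 := Real.rpow_pos_of_pos hk α₁
    have h2 := Real.rpow_pos_of_pos hk α₂
    rw [Real.rpow_sub hk, Real.norm_of_nonneg (by positivity), Real.norm_of_nonneg (by positivity)]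
    refine le_of_eq ?_
    field_simp

lemma tendsto_add_one_rpow_neg {δ : ℝ} (hδ : δ < 0) :
    Tendsto (fun k : ℕ => ((k : ℝ) + 1) ^ δ) atTop (𝓝 0) := by
  have h := (tendsto_rpow_neg_atTop (y := -δ) (by linarith)).comp
    (tendsto_atTop_add_const_right _ (1 : ℝ) tendsto_natCast_atTop_atTop (α := ℕ))
  simpa [Function.comp_def] using h

lemma tendsto_relative {α₁ α₂ c₁ c₂ : ℝ} (h₁₂ : α₁ < α₂) (hc₁ : 0 < c₁) {ν : ℕ → ℝ}
    (hν : (fun k : ℕ => ν k - (c₁ / ((k : ℝ) + 1) ^ α₁ + c₂ / ((k : ℝ) + 1) ^ α₂)) =o[atTop]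
      fun k : ℕ => 1 / ((k : ℝ) + 1) ^ α₂) :
    Tendsto (fun k : ℕ => ν k * ((k : ℝ) + 1) ^ α₁ / c₁) atTop (𝓝 1) := by
  have h0 := tendsto_add_one_rpow_neg (δ := α₁ - α₂) (by linarith)
  have h1 := (relative_expansion hc₁ hν).isBigO.trans_tendsto h0
  have h2 := (h1.add (h0.const_mul (c₂ / c₁))).add_const 1
  simp only [mul_zero, add_zero, zero_add] at h2
  refine h2.congr fun k => ?_
  ring

/-- Termwise, log νₖ = log c₁ - α₁ log (k+1) + (c₂/c₁)(k+1)^(p-1) + o((k+1)^(p-1)). Summation turns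
the second term into log n! and the third into n^p/p. -/
lemma sum_log_expansion {α₁ α₂ c₁ c₂ : ℝ} (h₁₂ : α₁ < α₂) (h₂₁ : α₂ < α₁ + 1) (hc₁ : 0 < c₁)
    {ν : ℕ → ℝ} (hpos : ∀ k, 0 < ν k)
    (hν : (fun k : ℕ => ν k - (c₁ / ((k : ℝ) + 1) ^ α₁ + c₂ / ((k : ℝ) + 1) ^ α₂)) =o[atTop]
      fun k : ℕ => 1 / ((k : ℝ) + 1) ^ α₂) :
    (fun n : ℕ => ∑ k ∈ Finset.range n, Real.log (ν k) -
        (n * Real.log c₁ - α₁ * (n * Real.log n - n) +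
          c₂ / c₁ / (α₁ - α₂ + 1) * (n : ℝ) ^ (α₁ - α₂ + 1)))
      =o[atTop] fun n : ℕ => (n : ℝ) ^ (α₁ - α₂ + 1) := by
  set p := α₁ - α₂ + 1 with hp
  have hp0 : 0 < p := by linarith
  have hp1 : p < 1 := by linarith
  have hpe : α₁ - α₂ = p - 1 := by ring
  set y : ℕ → ℝ := fun k => ν k * ((k : ℝ) + 1) ^ α₁ / c₁ - 1 with hy
  have hrel := relative_expansion hc₁ hν
  rw [hpe] at hrel
  have hy0 : Tendsto y atTop (𝓝 0) := by
    simpa using (tendsto_relative h₁₂ hc₁ hν).sub_const 1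
  have hyO : y =O[atTop] fun k : ℕ => ((k : ℝ) + 1) ^ (p - 1) := by
    have h := hrel.isBigO.add ((isBigO_refl (fun k : ℕ => ((k : ℝ) + 1) ^ (p - 1)) atTop).const_mul_left
      (c₂ / c₁))
    refine h.congr_left fun k => ?_
    ring
  have hterm : (fun k : ℕ => Real.log (ν k) - (Real.log c₁ - α₁ * Real.log ((k : ℝ) + 1) +
      c₂ / c₁ * ((k : ℝ) + 1) ^ (p - 1))) =o[atTop] fun k : ℕ => ((k : ℝ) + 1) ^ (p - 1) := by
    refine (((log_one_add_sub_isLittleO hy0).trans_isBigO hyO).add hrel).congr_left fun k => ?_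
    have hk : (0 : ℝ) < (k : ℝ) + 1 := by positivity
    have h1 : 1 + y k = ν k * ((k : ℝ) + 1) ^ α₁ / c₁ := by rw [hy]; ring
    rw [h1, Real.log_div (mul_pos (hpos k) (Real.rpow_pos_of_pos hk _)).ne' hc₁.ne',
      Real.log_mul (hpos k).ne' (Real.rpow_pos_of_pos hk _).ne', Real.log_rpow hk]
    simp only [hy]
    ring
  have hsumO : (fun n : ℕ => ∑ k ∈ Finset.range n, ((k : ℝ) + 1) ^ (p - 1)) =O[atTop]
      fun n : ℕ => (n : ℝ) ^ p := by
    have h := (sum_rpow_sub_isLittleO hp0 hp1).isBigO.add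
      ((isBigO_refl (fun n : ℕ => (n : ℝ) ^ p) atTop).const_mul_left (1 / p))
    refine h.congr_left fun n => ?_
    ring
  -- Little-o estimates may be summed because the comparison series diverges, which uses p > 0.
  have hsumtop : Tendsto (fun n : ℕ => ∑ k ∈ Finset.range n, ((k : ℝ) + 1) ^ (p - 1)) atTop
      atTop := by
    refine tendsto_atTop_mono (f := fun n : ℕ => ((n : ℝ) ^ p - 1) / p) (fun n => ?_) ?_
    · rw [div_le_iff₀ hp0, mul_comm]
      exact le_sum_rpow hp0 hp1 n
    · exact (tendsto_atTop_add_const_right _ (-1) (tendsto_natCast_rpow_atTop hp0)).atTop_div_const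
        hp0
  have h1 := (hterm.sum_range (fun k => by positivity) hsumtop).trans_isBigO hsumO
  have h2 := (h1.add ((log_factorial_sub_isLittleO hp0).const_mul_left (-α₁))).add
    ((sum_rpow_sub_isLittleO hp0 hp1).const_mul_left (c₂ / c₁))
  refine h2.congr_left fun n => ?_
  have hfac : ∑ k ∈ Finset.range n, Real.log ((k : ℝ) + 1) = Real.log n.factorial := by
    rw [← Finset.prod_range_add_one_eq_factorial, Nat.cast_prod, Real.log_prod]
    · simp
    · intro k _
      positivity
  rw [Finset.sum_sub_distrib, Finset.sum_add_distrib, Finset.sum_sub_distrib, ← Finset.mul_sum,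
    ← Finset.mul_sum, hfac, Finset.sum_const, Finset.card_range, nsmul_eq_mul]
  ring

end SequenceAsymptotics

/-! ### The initial segment of axes longer than ε. -/

section Head

/-- The first `n` positive integers. -/
def head (n : ℕ) : Finset ℕ+ :=
  (Finset.range n).map ⟨Nat.succPNat, Nat.succPNat_injective⟩

lemma card_head (n : ℕ) : (head n).card = n := by simp [head]

lemma sum_head {β : Type*} [AddCommMonoid β] (f : ℕ+ → β) (n : ℕ) :
    ∑ m ∈ head n, f m = ∑ k ∈ Finset.range n, f k.succPNat := by
  simp [head]

lemma succPNat_mem_head {k n : ℕ} : k.succPNat ∈ head n ↔ k < n := by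
  simp [head]

/-- The number of leading semi-axes that exceed `ε`. -/
noncomputable def headCount (μ : ℕ+ → ℝ) (ε : ℝ) : ℕ := sInf {k | μ k.succPNat ≤ ε}

variable {μ : ℕ+ → ℝ}

lemma headCount_spec (hlim : Tendsto (fun k : ℕ => μ k.succPNat) atTop (𝓝 0)) {ε : ℝ}
    (hε : 0 < ε) : μ (headCount μ ε).succPNat ≤ ε := by
  obtain ⟨k, hk⟩ := (hlim.eventually (gt_mem_nhds hε)).exists
  exact Nat.sInf_mem (s := {k | μ k.succPNat ≤ ε}) ⟨k, hk.le⟩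

lemma lt_of_lt_headCount {ε : ℝ} {k : ℕ} (hk : k < headCount μ ε) : ε < μ k.succPNat :=
  not_le.1 fun h => Nat.notMem_of_lt_sInf hk h

lemma lt_headCount_iff (hanti : Antitone μ)
    (hlim : Tendsto (fun k : ℕ => μ k.succPNat) atTop (𝓝 0)) {ε : ℝ} (hε : 0 < ε) {k : ℕ} :
    k < headCount μ ε ↔ ε < μ k.succPNat := by
  refine ⟨lt_of_lt_headCount, fun h => ?_⟩
  by_contra hcon
  have h1 : μ k.succPNat ≤ μ (headCount μ ε).succPNat :=
    hanti (Nat.succPNat_le_succPNat.2 (not_lt.1 hcon))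
  linarith [headCount_spec hlim hε]

lemma mem_head_headCount_iff (hanti : Antitone μ)
    (hlim : Tendsto (fun k : ℕ => μ k.succPNat) atTop (𝓝 0)) {ε : ℝ} (hε : 0 < ε) (n : ℕ+) :
    n ∈ head (headCount μ ε) ↔ ε < μ n := by
  rw [← PNat.succPNat_natPred n, succPNat_mem_head, lt_headCount_iff hanti hlim hε]

end Head

/-! ### The effective dimension and the number of long axes. -/

section EffectiveDimension

/-- The effective dimension `(c / ε) ^ (1 / α)`. -/
noncomputable def effDim (c α ε : ℝ) : ℝ := (c / ε) ^ (1 / α)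

lemma effDim_pos {c α ε : ℝ} (hc : 0 < c) (hε : 0 < ε) : 0 < effDim c α ε :=
  Real.rpow_pos_of_pos (div_pos hc hε) _

lemma effDim_rpow {c α ε : ℝ} (hc : 0 < c) (hα : 0 < α) (hε : 0 < ε) :
    effDim c α ε ^ α = c / ε := by
  rw [effDim, ← Real.rpow_mul (div_pos hc hε).le, one_div_mul_cancel hα.ne', Real.rpow_one]

lemma tendsto_effDim {c α : ℝ} (hc : 0 < c) (hα : 0 < α) :
    Tendsto (effDim c α) (𝓝[>] 0) atTop :=
  (tendsto_rpow_atTop (one_div_pos.2 hα)).comp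
    (tendsto_inv_nhdsGT_zero.const_mul_atTop hc)

lemma isLittleO_rpow_rpow_atTop_of_lt {q p : ℝ} (hqp : q < p) :
    (fun x : ℝ => x ^ q) =o[atTop] fun x : ℝ => x ^ p := by
  refine isLittleO_of_tendsto' ?_ ?_
  · filter_upwards [eventually_gt_atTop 0] with x hx h
    exact absurd h (Real.rpow_pos_of_pos hx p).ne'
  · refine (tendsto_rpow_neg_atTop (sub_pos.2 hqp)).congr' ?_
    filter_upwards [eventually_gt_atTop 0] with x hx
    rw [← Real.rpow_sub hx, neg_sub]

lemma isLittleO_log_effDim {c α p C : ℝ} (hc : 0 < c) (hα : 0 < α) (hp : 0 < p) (hC : 0 < C)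
    (q : ℝ) : (fun ε => Real.log (C * effDim c α ε ^ q)) =o[𝓝[>] 0] fun ε => effDim c α ε ^ p := by
  have h1 : (fun x : ℝ => Real.log C + q * Real.log x) =o[atTop] fun x : ℝ => x ^ p :=
    (isLittleO_const_left.2 (Or.inr (tendsto_norm_atTop_atTop.comp (tendsto_rpow_atTop hp)))).add
      ((isLittleO_log_rpow_atTop hp).const_mul_left q)
  refine (h1.comp_tendsto (tendsto_effDim hc hα)).congr' ?_ EventuallyEq.rfl
  filter_upwards [self_mem_nhdsWithin] with ε hε
  have hR := effDim_pos (α := α) hc hε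
  rw [Function.comp_apply, Real.log_mul hC.ne' (Real.rpow_pos_of_pos hR q).ne', Real.log_rpow hR]

lemma isLittleO_effDim_rpow {c α p q : ℝ} (hc : 0 < c) (hα : 0 < α) (hqp : q < p) :
    (fun ε => effDim c α ε ^ q) =o[𝓝[>] 0] fun ε => effDim c α ε ^ p :=
  (isLittleO_rpow_rpow_atTop_of_lt hqp).comp_tendsto (tendsto_effDim hc hα)

lemma isLittleO_effDim_const {c α p : ℝ} (hc : 0 < c) (hα : 0 < α) (hp : 0 < p) (C : ℝ) :
    (fun _ => C) =o[𝓝[>] 0] fun ε => effDim c α ε ^ p :=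
  isLittleO_const_left.2 (Or.inr (tendsto_norm_atTop_atTop.comp
    ((tendsto_rpow_atTop hp).comp (tendsto_effDim hc hα))))

/-- With d the count at level e(ε), one has μ_(d+1) ≤ e(ε) < μ_d in the numbering from 1. Inserting
μₙ ~ c/n^α on both sides squeezes d/R. -/
lemma headCount_div_effDim_tendsto {μ : ℕ+ → ℝ} (hpos : ∀ n, 0 < μ n) (hanti : Antitone μ)
    (hlim : Tendsto (fun k : ℕ => μ k.succPNat) atTop (𝓝 0)) {c α : ℝ} (hc : 0 < c) (hα : 0 < α)
    (hrel : Tendsto (fun k : ℕ => μ k.succPNat * ((k : ℝ) + 1) ^ α / c) atTop (𝓝 1))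
    {e : ℝ → ℝ} (he0 : ∀ᶠ ε in 𝓝[>] 0, 0 < e ε) (hele : ∀ᶠ ε in 𝓝[>] 0, e ε ≤ ε)
    (he : Tendsto (fun ε => e ε / ε) (𝓝[>] 0) (𝓝 1)) :
    Tendsto (fun ε => (headCount μ (e ε) : ℝ) / effDim c α ε) (𝓝[>] 0) (𝓝 1) := by
  set θ : ℕ → ℝ := fun k => μ k.succPNat * ((k : ℝ) + 1) ^ α / c with hθ
  set d : ℝ → ℕ := fun ε => headCount μ (e ε) with hd
  have hdtop : Tendsto d (𝓝[>] 0) atTop := by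
    refine tendsto_atTop.2 fun N => ?_
    have hN : ∀ᶠ ε in 𝓝[>] (0 : ℝ), ε < μ N.succPNat :=
      mem_nhdsWithin_of_mem_nhds (gt_mem_nhds (hpos _))
    filter_upwards [he0, hele, hN] with ε h0 h1 h2
    exact ((lt_headCount_iff hanti hlim h0).2 (h1.trans_lt h2)).le
  -- The index d of `θ` refers to axis d + 1, whence the correction 1/R.
  have hθ1 : Tendsto (fun ε => θ (d ε) ^ (1 / α) - 1 / effDim c α ε) (𝓝[>] 0) (𝓝 1) := by
    have h1 := (hrel.comp hdtop).rpow_const (p := 1 / α) (Or.inl one_ne_zero)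
    have h2 := (tendsto_effDim hc hα).const_div_atTop 1
    simpa [Function.comp_def] using h1.sub h2
  have hθ2 : Tendsto (fun ε => (θ (d ε - 1) / (e ε / ε)) ^ (1 / α)) (𝓝[>] 0) (𝓝 1) := by
    have h1 := ((hrel.comp ((tendsto_sub_atTop_nat 1).comp hdtop)).div he one_ne_zero).rpow_const
      (p := 1 / α) (Or.inl (by norm_num))
    simpa [Function.comp_def] using h1
  refine tendsto_of_tendsto_of_tendsto_of_le_of_le' hθ1 hθ2 ?_ ?_
  · filter_upwards [he0, hele, self_mem_nhdsWithin] with ε h0 h1 (h2 : 0 < ε)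
    have hR := effDim_pos (α := α) hc h2
    rw [sub_le_iff_le_add, ← add_div]
    have h3 : θ (d ε) ≤ (((d ε : ℝ) + 1) / effDim c α ε) ^ α := by
      rw [Real.div_rpow (by positivity) hR.le, effDim_rpow hc hα h2]
      have h4 : μ (d ε).succPNat ≤ ε := (headCount_spec hlim h0).trans h1
      calc θ (d ε) ≤ ε * ((d ε : ℝ) + 1) ^ α / c := by
            simp only [hθ]
            gcongr
        _ = _ := by field_simp
    have hθ0 : 0 ≤ θ (d ε) := by
      have := hpos (d ε).succPNat
      simp only [hθ]
      positivity
    calc θ (d ε) ^ (1 / α) ≤ ((((d ε : ℝ) + 1) / effDim c α ε) ^ α) ^ (1 / α) :=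
          Real.rpow_le_rpow hθ0 h3 (by positivity)
      _ = _ := by
          rw [← Real.rpow_mul (by positivity), mul_one_div_cancel hα.ne', Real.rpow_one]
  · filter_upwards [he0, hele, self_mem_nhdsWithin, hdtop.eventually_ge_atTop 1] with ε h0 h1
      (h2 : 0 < ε) h3
    have hR := effDim_pos (α := α) hc h2
    have h4 : e ε < μ (d ε - 1).succPNat := lt_of_lt_headCount (show d ε - 1 < d ε by omega)
    have h5 : (((d ε - 1 : ℕ) : ℝ) + 1) = d ε := by
      rw [Nat.cast_sub h3]
      simp
    have h6 : ((d ε : ℝ) / effDim c α ε) ^ α ≤ θ (d ε - 1) / (e ε / ε) := by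
      rw [Real.div_rpow (by positivity) hR.le, effDim_rpow hc hα h2]
      simp only [hθ, h5]
      rw [le_div_iff₀ (by positivity)]
      calc (d ε : ℝ) ^ α / (c / ε) * (e ε / ε) = e ε * (d ε : ℝ) ^ α / c := by field_simp
        _ ≤ _ := by gcongr
    calc (d ε : ℝ) / effDim c α ε = (((d ε : ℝ) / effDim c α ε) ^ α) ^ (1 / α) := by
          rw [← Real.rpow_mul (by positivity), mul_one_div_cancel hα.ne', Real.rpow_one]
      _ ≤ _ := Real.rpow_le_rpow (by positivity) h6 (by positivity)

/-- A is at least of order R: for j = ⌊κR⌋ with κ^α = 1/4, the first j axes are at least c/(2j^α) ≥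
2ε long, so each has weight at least 1 - 1/4. -/
lemma eventually_effDim_le_sum_waterWeight {μ : ℕ+ → ℝ} (hanti : Antitone μ)
    (hlim : Tendsto (fun k : ℕ => μ k.succPNat) atTop (𝓝 0)) {c α : ℝ} (hc : 0 < c) (hα : 0 < α)
    (hrel : Tendsto (fun k : ℕ => μ k.succPNat * ((k : ℝ) + 1) ^ α / c) atTop (𝓝 1))
    {e : ℝ → ℝ} (he0 : ∀ᶠ ε in 𝓝[>] 0, 0 < e ε) (hele : ∀ᶠ ε in 𝓝[>] 0, e ε ≤ ε) :
    ∀ᶠ ε in 𝓝[>] 0, (1 / 4 : ℝ) ^ (1 / α) / 4 * effDim c α ε ≤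
      ∑ n ∈ head (headCount μ (e ε)), waterWeight (e ε) (μ n) := by
  set κ : ℝ := (1 / 4 : ℝ) ^ (1 / α) with hκ
  have hκ0 : 0 < κ := by positivity
  have hκα : κ ^ α = 1 / 4 := by
    rw [hκ, ← Real.rpow_mul (by norm_num), one_div_mul_cancel hα.ne', Real.rpow_one]
  have hR := (tendsto_effDim (c := c) (α := α) hc hα).const_mul_atTop hκ0
  have hj : Tendsto (fun ε => ⌊κ * effDim c α ε⌋₊ - 1) (𝓝[>] 0) atTop :=
    (tendsto_sub_atTop_nat 1).comp (tendsto_nat_floor_atTop.comp hR)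
  have hθ := (hrel.comp hj).eventually (lt_mem_nhds (show (1 / 2 : ℝ) < 1 by norm_num))
  filter_upwards [he0, hele, self_mem_nhdsWithin, hθ, hR.eventually_ge_atTop 2] with ε h0 h1
    (h2 : 0 < ε) h3 h4
  set R := effDim c α ε with hRdef
  have hR0 : 0 < R := effDim_pos hc h2
  set j := ⌊κ * R⌋₊ with hjdef
  have hj1 : 1 ≤ j := Nat.le_floor (by push_cast; linarith)
  have hjle : (j : ℝ) ≤ κ * R := Nat.floor_le (by positivity)
  have hjlt : κ * R < j + 1 := Nat.lt_floor_add_one _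
  have h5 : (((j - 1 : ℕ) : ℝ) + 1) = j := by
    rw [Nat.cast_sub hj1]
    simp
  have h6 : 2 * e ε ≤ μ (j - 1).succPNat := by
    change 1 / 2 < μ (j - 1).succPNat * (((j - 1 : ℕ) : ℝ) + 1) ^ α / c at h3
    rw [h5] at h3
    have hj0 : (0 : ℝ) < j := by exact_mod_cast hj1
    have h7 : (j : ℝ) ^ α ≤ 1 / 4 * (c / ε) := by
      calc (j : ℝ) ^ α ≤ (κ * R) ^ α := Real.rpow_le_rpow hj0.le hjle hα.le
        _ = 1 / 4 * (c / ε) := by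
          rw [Real.mul_rpow hκ0.le hR0.le, hκα, hRdef, effDim_rpow hc hα h2]
    have h8 : 0 < (j : ℝ) ^ α := Real.rpow_pos_of_pos hj0 _
    rw [lt_div_iff₀ hc] at h3
    by_contra hcon
    push Not at hcon
    have h9 : μ (j - 1).succPNat < 2 * ε := by linarith
    have h10 : μ (j - 1).succPNat * (j : ℝ) ^ α ≤ 2 * ε * (1 / 4 * (c / ε)) := by gcongr
    have h11 : 2 * ε * (1 / 4 * (c / ε)) = 1 / 2 * c := by
      field_simp
      norm_num
    linarith
  have hjd : j ≤ headCount μ (e ε) := by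
    have := (lt_headCount_iff hanti hlim h0 (k := j - 1)).2 (by linarith)
    omega
  rw [sum_head]
  have h7 : ∑ k ∈ Finset.range j, (3 / 4 : ℝ) ≤
      ∑ k ∈ Finset.range j, waterWeight (e ε) (μ k.succPNat) := by
    refine Finset.sum_le_sum fun k hk => ?_
    have hk' : k < j := Finset.mem_range.1 hk
    have h8 : 2 * e ε ≤ μ k.succPNat :=
      h6.trans (hanti (Nat.succPNat_le_succPNat.2 (by omega)))
    have h9 : e ε / μ k.succPNat ≤ 1 / 2 := by
      rw [div_le_iff₀ (by linarith)]
      linarith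
    have h10 : 0 ≤ e ε / μ k.succPNat := div_nonneg h0.le (by linarith)
    unfold waterWeight
    nlinarith
  rw [Finset.sum_const, Finset.card_range, nsmul_eq_mul] at h7
  have h8 : ∑ k ∈ Finset.range j, waterWeight (e ε) (μ k.succPNat) ≤
      ∑ k ∈ Finset.range (headCount μ (e ε)), waterWeight (e ε) (μ k.succPNat) := by
    refine Finset.sum_le_sum_of_subset_of_nonneg (Finset.range_subset_range.2 hjd) fun k hk _ => ?_
    exact (waterWeight_pos h0 (lt_of_lt_headCount (Finset.mem_range.1 hk))).le
  linarith

/-- Partial sums of `log (νₖ / ε)` up to an index equivalent to the effective dimension. -/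
lemma sum_log_div_isLittleO {α₁ α₂ c₁ c₂ : ℝ} (hα₁ : 0 < α₁) (h₁₂ : α₁ < α₂)
    (h₂₁ : α₂ < α₁ + 1) (hc₁ : 0 < c₁) {ν : ℕ → ℝ} (hpos : ∀ k, 0 < ν k)
    (hν : (fun k : ℕ => ν k - (c₁ / ((k : ℝ) + 1) ^ α₁ + c₂ / ((k : ℝ) + 1) ^ α₂)) =o[atTop]
      fun k : ℕ => 1 / ((k : ℝ) + 1) ^ α₂)
    {D : ℝ → ℕ} (hD : Tendsto (fun ε => (D ε : ℝ) / effDim c₁ α₁ ε) (𝓝[>] 0) (𝓝 1)) :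
    (fun ε => ∑ k ∈ Finset.range (D ε), Real.log (ν k / ε) -
        (α₁ * (D ε * (Real.log (effDim c₁ α₁ ε) - Real.log (D ε)) + D ε) +
          c₂ / c₁ / (α₁ - α₂ + 1) * effDim c₁ α₁ ε ^ (α₁ - α₂ + 1)))
      =o[𝓝[>] 0] fun ε => effDim c₁ α₁ ε ^ (α₁ - α₂ + 1) := by
  set p := α₁ - α₂ + 1 with hp
  have hp0 : 0 < p := by linarith
  have hRtop := tendsto_effDim (c := c₁) (α := α₁) hc₁ hα₁
  have hDtop : Tendsto D (𝓝[>] 0) atTop := by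
    have h1 := hD.pos_mul_atTop one_pos hRtop
    refine tendsto_natCast_atTop_iff.1 (h1.congr' ?_)
    filter_upwards [self_mem_nhdsWithin] with ε hε
    exact div_mul_cancel₀ _ (effDim_pos hc₁ hε).ne'
  have hDp : Tendsto (fun ε => (D ε : ℝ) ^ p / effDim c₁ α₁ ε ^ p) (𝓝[>] 0) (𝓝 1) := by
    have h1 := hD.rpow_const (p := p) (Or.inl one_ne_zero)
    rw [Real.one_rpow] at h1
    refine h1.congr' ?_
    filter_upwards [self_mem_nhdsWithin] with ε hε
    exact Real.div_rpow (Nat.cast_nonneg _) (effDim_pos hc₁ hε).le _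
  have hne : ∀ᶠ ε in 𝓝[>] 0, effDim c₁ α₁ ε ^ p ≠ 0 := by
    filter_upwards [self_mem_nhdsWithin] with ε hε
    exact (Real.rpow_pos_of_pos (effDim_pos hc₁ hε) p).ne'
  have hequiv : (fun ε => (D ε : ℝ) ^ p) ~[𝓝[>] 0] fun ε => effDim c₁ α₁ ε ^ p :=
    (isEquivalent_iff_tendsto_one hne).2 hDp
  have h1 := ((sum_log_expansion h₁₂ h₂₁ hc₁ hpos hν).comp_tendsto hDtop).trans_isBigO
    hequiv.isBigO
  have h2 := hequiv.isLittleO.const_mul_left (c₂ / c₁ / p)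
  refine (h1.add h2).congr' ?_ EventuallyEq.rfl
  filter_upwards [self_mem_nhdsWithin] with ε (hε : 0 < ε)
  have hlogR : α₁ * Real.log (effDim c₁ α₁ ε) = Real.log c₁ - Real.log ε := by
    rw [← Real.log_rpow (effDim_pos hc₁ hε), effDim_rpow hc₁ hα₁ hε,
      Real.log_div hc₁.ne' hε.ne']
  have hsum : ∑ k ∈ Finset.range (D ε), Real.log (ν k / ε) =
      ∑ k ∈ Finset.range (D ε), Real.log (ν k) - D ε * Real.log ε := by
    simp_rw [Real.log_div (hpos _).ne' hε.ne']
    rw [Finset.sum_sub_distrib, Finset.sum_const, Finset.card_range, nsmul_eq_mul]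
  simp only [Function.comp_apply, Pi.sub_apply]
  rw [hsum]
  linear_combination (D ε : ℝ) * hlogR

end EffectiveDimension

/-! ### Matching asymptotic bounds for the entropy. -/

section Entropy

lemma log_lower_le_entropy {μ : ℕ+ → ℝ} (hpos : ∀ n, 0 < μ n)
    (hfin : ∀ ε : ℝ, 0 < ε → coveringNum ε (ellipsoid μ) ≠ ⊤) {α₁ α₂ c₁ c₂ : ℝ} (hα₁ : 0 < α₁)
    (h₁₂ : α₁ < α₂) (h₂₁ : α₂ < α₁ + 1) (hc₁ : 0 < c₁)
    (hν : (fun k : ℕ => μ k.succPNat - (c₁ / ((k : ℝ) + 1) ^ α₁ + c₂ / ((k : ℝ) + 1) ^ α₂))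
      =o[atTop] fun k : ℕ => 1 / ((k : ℝ) + 1) ^ α₂) :
    ∃ g : ℝ → ℝ, g =o[𝓝[>] 0] (fun ε => effDim c₁ α₁ ε ^ (α₁ - α₂ + 1)) ∧
      ∀ᶠ ε in 𝓝[>] 0, g ε ≤ Real.log (coveringNum ε (ellipsoid μ)).toNat -
        (α₁ * effDim c₁ α₁ ε +
          c₂ / c₁ / (α₁ - α₂ + 1) * effDim c₁ α₁ ε ^ (α₁ - α₂ + 1)) := by
  have hRtop := tendsto_effDim (c := c₁) (α := α₁) hc₁ hα₁
  have hD : Tendsto (fun ε => (⌊effDim c₁ α₁ ε⌋₊ : ℝ) / effDim c₁ α₁ ε) (𝓝[>] 0) (𝓝 1) :=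
    tendsto_nat_floor_div_atTop.comp hRtop
  have h := sum_log_div_isLittleO hα₁ h₁₂ h₂₁ hc₁ (fun k => hpos _) hν hD
  refine ⟨_, h.sub (isLittleO_effDim_const hc₁ hα₁ (by linarith) α₁), ?_⟩
  filter_upwards [self_mem_nhdsWithin, hRtop.eventually_ge_atTop 1] with ε (hε : 0 < ε) hR1
  have h1 := sum_log_le_log_coveringNum hpos hε (hfin ε hε) (head ⌊effDim c₁ α₁ ε⌋₊)
  rw [sum_head] at h1
  set R := effDim c₁ α₁ ε
  have h2 : (1 : ℝ) ≤ (⌊R⌋₊ : ℝ) := by exact_mod_cast Nat.le_floor (by exact_mod_cast hR1)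
  have h3 : Real.log (⌊R⌋₊ : ℝ) ≤ Real.log R :=
    Real.log_le_log (by linarith) (Nat.floor_le (by linarith))
  have h4 : R < ⌊R⌋₊ + 1 := Nat.lt_floor_add_one R
  -- Rounding R down costs at most the constant α₁.
  have h5 : α₁ * (R - 1) ≤ α₁ * (⌊R⌋₊ * (Real.log R - Real.log ⌊R⌋₊) + ⌊R⌋₊) := by
    have : 0 ≤ (⌊R⌋₊ : ℝ) * (Real.log R - Real.log ⌊R⌋₊) :=
      mul_nonneg (by positivity) (by linarith)
    gcongr
    linarith
  linarith

lemma exists_head_card_le {μ : ℕ+ → ℝ} {C α : ℝ} (hα : 0 < α) (hC : 0 < C)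
    (hbd : ∀ k : ℕ, μ k.succPNat * ((k : ℝ) + 1) ^ α ≤ C) {r : ℝ} (hr : 0 < r) :
    ∀ n ∉ head ⌈(C / r) ^ (1 / α)⌉₊, μ n ≤ r := by
  intro n hn
  rw [← PNat.succPNat_natPred n, succPNat_mem_head, not_lt] at hn
  have h1 := hbd n.natPred
  rw [PNat.succPNat_natPred] at h1
  have h2 : (C / r) ^ (1 / α) ≤ (n.natPred : ℝ) + 1 :=
    (Nat.le_ceil _).trans (by
      have : (⌈(C / r) ^ (1 / α)⌉₊ : ℝ) ≤ n.natPred := by exact_mod_cast hn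
      linarith)
  have h3 : C / r ≤ ((n.natPred : ℝ) + 1) ^ α := by
    calc C / r = ((C / r) ^ (1 / α)) ^ α := by
          rw [← Real.rpow_mul (by positivity), one_div_mul_cancel hα.ne', Real.rpow_one]
      _ ≤ _ := Real.rpow_le_rpow (by positivity) h2 hα.le
  by_contra hcon
  push Not at hcon
  rw [div_le_iff₀ hr] at h3
  have h4 : 0 < ((n.natPred : ℝ) + 1) ^ α := by positivity
  nlinarith

/-- The left side is concave in D with maximum R at D = R. Hence the upper bound needs D only up to
equivalence. -/
lemma mul_sub_log_add_le {R D : ℝ} (hR : 0 < R) (hD : 0 < D) :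
    D * (Real.log R - Real.log D) + D ≤ R := by
  have h := Real.log_le_sub_one_of_pos (div_pos hR hD)
  rw [Real.log_div hR.ne' hD.ne'] at h
  have h1 : D * (Real.log R - Real.log D) ≤ D * (R / D - 1) := by gcongr
  have h2 : D * (R / D - 1) = R - D := by field_simp
  linarith

lemma radius_le {κ x ε K A : ℝ} (hκ : 0 < κ) (hx : 0 < x) (hε : 0 < ε)
    (hK : 10 / Real.sqrt κ + 1 ≤ K) (hA : κ * x ≤ A) :
    ε / (1 + K / Real.sqrt x) * (1 + 10 / Real.sqrt A) +
      ε / (1 + K / Real.sqrt x) / Real.sqrt x ≤ ε := by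
  have hsx : 0 < Real.sqrt x := Real.sqrt_pos.2 hx
  have hK0 : 0 ≤ K := le_trans (by positivity) hK
  have hden : 0 < 1 + K / Real.sqrt x := by positivity
  have h1 : 10 / Real.sqrt A ≤ 10 / Real.sqrt κ / Real.sqrt x := by
    rw [div_div, ← Real.sqrt_mul hκ.le]
    gcongr
  have h2 : (10 / Real.sqrt κ + 1) / Real.sqrt x ≤ K / Real.sqrt x := by gcongr
  rw [add_div] at h2
  calc ε / (1 + K / Real.sqrt x) * (1 + 10 / Real.sqrt A) +
        ε / (1 + K / Real.sqrt x) / Real.sqrt x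
      = ε / (1 + K / Real.sqrt x) * (1 + 10 / Real.sqrt A + 1 / Real.sqrt x) := by ring
    _ ≤ ε / (1 + K / Real.sqrt x) * (1 + K / Real.sqrt x) := by
      gcongr ?_ * ?_
      linarith
    _ = ε := div_mul_cancel₀ _ hden.ne'

lemma sum_log_div_le {ν : ℕ → ℝ} (hν : ∀ k, 0 < ν k) {ε x K : ℝ} (hε : 0 < ε) (hx : 0 < x)
    (hK : 0 ≤ K) {D : ℕ} (hD : (D : ℝ) ≤ 2 * x) :
    ∑ k ∈ Finset.range D, Real.log (ν k / (ε / (1 + K / Real.sqrt x))) ≤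
      ∑ k ∈ Finset.range D, Real.log (ν k / ε) + 2 * K * x ^ (1 / 2 : ℝ) := by
  have h2 : 0 < 1 + K / Real.sqrt x := by positivity
  have h1 : ∀ k : ℕ, Real.log (ν k / (ε / (1 + K / Real.sqrt x))) ≤
      Real.log (ν k / ε) + K / Real.sqrt x := by
    intro k
    have h3 : ν k / (ε / (1 + K / Real.sqrt x)) = ν k / ε * (1 + K / Real.sqrt x) := by
      rw [div_div_eq_mul_div]
      ring
    rw [h3, Real.log_mul (div_pos (hν _) hε).ne' h2.ne']
    linarith [Real.log_le_sub_one_of_pos h2]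
  refine (Finset.sum_le_sum fun k _ => h1 k).trans ?_
  rw [Finset.sum_add_distrib, Finset.sum_const, Finset.card_range, nsmul_eq_mul,
    ← Real.sqrt_eq_rpow]
  refine add_le_add le_rfl ?_
  calc (D : ℝ) * (K / Real.sqrt x) ≤ 2 * x * (K / Real.sqrt x) := by gcongr
    _ = 2 * K * (x / Real.sqrt x) := by ring
    _ = 2 * K * Real.sqrt x := by rw [Real.div_sqrt]

/-- With `grid_dim_le` and `grid_le`, this bounds the number of energy classes and the net's
log-size by powers of x, the effective dimension, so that their logarithms are negligible. -/
lemma one_add_ceil_le {x s M e c α : ℝ} (hx : 1 ≤ x) (hs1 : 1 ≤ s) (hs : s ≤ 2 * x) (he : 0 < e)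
    (hα : 0 < α) (heinv : 1 / e ≤ 2 / c * x ^ α) :
    (1 + ⌈(s + 1) * s * M ^ 2 / e ^ 2⌉₊ : ℝ) ≤
      (2 + 8 * M ^ 2 * (2 / c) ^ 2) * x ^ (2 + 2 * α) := by
  have hx0 : 0 < x := by linarith
  have h1 : (⌈(s + 1) * s * M ^ 2 / e ^ 2⌉₊ : ℝ) ≤ (s + 1) * s * M ^ 2 / e ^ 2 + 1 :=
    (Nat.ceil_lt_add_one (by positivity)).le
  have h2 : (s + 1) * s * M ^ 2 / e ^ 2 ≤ 8 * M ^ 2 * (2 / c) ^ 2 * x ^ (2 + 2 * α) := by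
    calc (s + 1) * s * M ^ 2 / e ^ 2 ≤ (2 * s) * s * M ^ 2 / e ^ 2 := by
          gcongr
          linarith
      _ = 2 * s ^ 2 * M ^ 2 * (1 / e) ^ 2 := by ring
      _ ≤ 2 * (2 * x) ^ 2 * M ^ 2 * (2 / c * x ^ α) ^ 2 := by gcongr
      _ = _ := by
        rw [Real.rpow_add hx0, Real.rpow_two, two_mul α, Real.rpow_add hx0]
        ring
  have h4 : 1 ≤ x ^ (2 + 2 * α) := Real.one_le_rpow hx (by positivity)
  rw [add_mul 2]
  linarith

lemma grid_dim_le {x C r c α b : ℝ} (hx : 1 ≤ x) (hC : 0 < C) (hr : 0 < r) (hc : 0 < c)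
    (hα : 0 < α) (hb : 0 < b) (hrinv : 1 / r ≤ 2 / c * x ^ b) :
    (⌈(C / (r / 4)) ^ (1 / α)⌉₊ : ℝ) ≤
      ((4 * C * (2 / c)) ^ (1 / α) + 1) * x ^ (b * (1 / α)) := by
  have hx0 : 0 < x := by linarith
  have h1 : (⌈(C / (r / 4)) ^ (1 / α)⌉₊ : ℝ) ≤ (C / (r / 4)) ^ (1 / α) + 1 :=
    (Nat.ceil_lt_add_one (by positivity)).le
  have h2 : C / (r / 4) ≤ 4 * C * (2 / c) * x ^ b := by
    calc C / (r / 4) = 4 * C * (1 / r) := by field_simp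
      _ ≤ 4 * C * (2 / c * x ^ b) := by gcongr
      _ = _ := by ring
  have h3 : (C / (r / 4)) ^ (1 / α) ≤ (4 * C * (2 / c)) ^ (1 / α) * x ^ (b * (1 / α)) := by
    refine (Real.rpow_le_rpow (by positivity) h2 (by positivity)).trans (le_of_eq ?_)
    rw [Real.mul_rpow (by positivity) (by positivity), ← Real.rpow_mul hx0.le]
  have h4 : 1 ≤ x ^ (b * (1 / α)) := Real.one_le_rpow hx (by positivity)
  rw [add_mul]
  linarith

lemma grid_le {x M E g r c a b : ℝ} (hx : 1 ≤ x) (hM : 0 < M) (hE : 1 ≤ E) (hg : 0 ≤ g)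
    (hr : 0 < r) (ha : 0 < a) (hb : 0 < b) (hrinv : 1 / r ≤ 2 / c * x ^ b)
    (hgle : g ≤ E * x ^ a) :
    2 * (g * (4 * M * (g + 1) / r + 1)) + 1 ≤
      (2 * (E * (4 * M * (E + 1) * (2 / c) + 1)) + 1) * x ^ (2 * a + b) := by
  have hx0 : 0 < x := by linarith
  have hxa : 1 ≤ x ^ a := Real.one_le_rpow hx ha.le
  have hxb : 1 ≤ x ^ b := Real.one_le_rpow hx hb.le
  have h1 : g + 1 ≤ (E + 1) * x ^ a := by linarith
  have h2 : 4 * M * (g + 1) / r + 1 ≤ (4 * M * (E + 1) * (2 / c) + 1) * (x ^ a * x ^ b) := by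
    have h3 : 1 ≤ x ^ a * x ^ b := one_le_mul_of_one_le_of_one_le hxa hxb
    calc 4 * M * (g + 1) / r + 1 = 4 * M * (g + 1) * (1 / r) + 1 := by ring
      _ ≤ 4 * M * ((E + 1) * x ^ a) * (2 / c * x ^ b) + x ^ a * x ^ b := by gcongr
      _ = _ := by ring
  have h4 : x ^ (2 * a + b) = x ^ a * (x ^ a * x ^ b) := by
    rw [two_mul, add_assoc, Real.rpow_add hx0, Real.rpow_add hx0]
  have h5 : 1 ≤ x ^ (2 * a + b) := Real.one_le_rpow hx (by positivity)
  calc 2 * (g * (4 * M * (g + 1) / r + 1)) + 1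
      ≤ 2 * ((E * x ^ a) * ((4 * M * (E + 1) * (2 / c) + 1) * (x ^ a * x ^ b))) +
        x ^ (2 * a + b) := by gcongr
    _ = _ := by
      rw [h4]
      ring

set_option maxHeartbeats 1000000 in
lemma entropy_le_log_upper {μ : ℕ+ → ℝ} (hpos : ∀ n, 0 < μ n) (hanti : Antitone μ)
    (hlim : Tendsto (fun k : ℕ => μ k.succPNat) atTop (𝓝 0))
    {α₁ α₂ c₁ c₂ : ℝ} (hα₁ : 0 < α₁)
    (h₁₂ : α₁ < α₂) (h₂₁ : α₂ < α₁ + 1 / 2) (hc₁ : 0 < c₁)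
    (hν : (fun k : ℕ => μ k.succPNat - (c₁ / ((k : ℝ) + 1) ^ α₁ + c₂ / ((k : ℝ) + 1) ^ α₂))
      =o[atTop] fun k : ℕ => 1 / ((k : ℝ) + 1) ^ α₂) :
    ∃ g : ℝ → ℝ, g =o[𝓝[>] 0] (fun ε => effDim c₁ α₁ ε ^ (α₁ - α₂ + 1)) ∧
      ∀ᶠ ε in 𝓝[>] 0, Real.log (coveringNum ε (ellipsoid μ)).toNat -
        (α₁ * effDim c₁ α₁ ε +
          c₂ / c₁ / (α₁ - α₂ + 1) * effDim c₁ α₁ ε ^ (α₁ - α₂ + 1)) ≤ g ε := by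
  have hrel := tendsto_relative h₁₂ hc₁ hν
  set R : ℝ → ℝ := effDim c₁ α₁ with hRdef
  set p := α₁ - α₂ + 1 with hp
  -- The condition α₂ < α₁ + 1/2, in the form that makes errors of order √R negligible against R^p.
  have hp2 : 1 / 2 < p := by linarith
  have hRtop : Tendsto R (𝓝[>] 0) atTop := tendsto_effDim hc₁ hα₁
  set κ : ℝ := (1 / 4 : ℝ) ^ (1 / α₁) / 4 with hκ
  have hκ0 : 0 < κ := by positivity
  -- As A ≥ κR, the codebook's excess 10/√A is at most (10/√κ)/√R; the extra 1 pays for the net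
  -- radius e(ε)/√R.
  set K : ℝ := 10 / Real.sqrt κ + 1 with hK
  have hK0 : 0 < K := by positivity
  set M := μ 1 with hM
  have hMle : ∀ n, μ n ≤ M := fun n => hanti (one_le)
  have hM0 : 0 < M := hpos 1
  obtain ⟨C, hC0, hC⟩ : ∃ C : ℝ, 0 < C ∧ ∀ k : ℕ, μ k.succPNat * ((k : ℝ) + 1) ^ α₁ ≤ C := by
    obtain ⟨b, hb⟩ := hrel.bddAbove_range
    refine ⟨max 1 (b * c₁), by positivity, fun k => le_max_of_le_right ?_⟩
    have := hb ⟨k, rfl⟩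
    rwa [div_le_iff₀ hc₁] at this
  set e : ℝ → ℝ := fun ε => ε / (1 + K / Real.sqrt (R ε)) with he
  have hR0 : ∀ {ε : ℝ}, 0 < ε → 0 < R ε := fun hε => effDim_pos hc₁ hε
  have he0 : ∀ᶠ ε in 𝓝[>] 0, 0 < e ε := by
    filter_upwards [self_mem_nhdsWithin] with ε (hε : 0 < ε)
    simp only [he]
    positivity
  have hele : ∀ᶠ ε in 𝓝[>] 0, e ε ≤ ε := by
    filter_upwards [self_mem_nhdsWithin] with ε (hε : 0 < ε)
    refine div_le_self hε.le ?_
    have : 0 ≤ K / Real.sqrt (R ε) := by positivity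
    linarith
  have hη : Tendsto (fun ε => K / Real.sqrt (R ε)) (𝓝[>] 0) (𝓝 0) :=
    (Real.tendsto_sqrt_atTop.comp hRtop).const_div_atTop K
  have hetend : Tendsto (fun ε => e ε / ε) (𝓝[>] 0) (𝓝 1) := by
    have h1 : Tendsto (fun ε => (1 + K / Real.sqrt (R ε))⁻¹) (𝓝[>] 0) (𝓝 1) := by
      simpa using (hη.const_add 1).inv₀ (by norm_num)
    refine h1.congr' ?_
    filter_upwards [self_mem_nhdsWithin] with ε (hε : 0 < ε)
    have : 0 < 1 + K / Real.sqrt (R ε) := by positivity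
    simp only [he]
    field_simp
  have hd := headCount_div_effDim_tendsto hpos hanti hlim hc₁ hα₁ hrel he0 hele hetend
  have hA := eventually_effDim_le_sum_waterWeight hanti hlim hc₁ hα₁ hrel he0 hele
  have hsum := sum_log_div_isLittleO hα₁ h₁₂ (by linarith) hc₁ (fun k => hpos _) hν hd
  set q : ℝ := 2 + 2 * α₁ with hq
  set E1 : ℝ := 2 + 8 * M ^ 2 * (2 / c₁) ^ 2 with hE1
  set b : ℝ := 1 + α₁ with hb
  set a : ℝ := b * (1 / α₁) with ha
  set E2 : ℝ := (4 * C * (2 / c₁)) ^ (1 / α₁) + 1 with hE2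
  set E3 : ℝ := 2 * (E2 * (4 * M * (E2 + 1) * (2 / c₁) + 1)) + 1 with hE3
  have ha0 : 0 < a := by positivity
  have hE20 : 1 ≤ E2 := by
    have : 0 ≤ (4 * C * (2 / c₁)) ^ (1 / α₁) := by positivity
    linarith
  have hE30 : 0 < E3 := by positivity
  have hpoly1 := isLittleO_log_effDim (c := c₁) (α := α₁) (p := p) (C := E1) hc₁ hα₁
    (by linarith) (by positivity) q
  have hpoly2 := isLittleO_log_effDim (c := c₁) (α := α₁) (p := p) (C := E3) hc₁ hα₁
    (by linarith) hE30 (2 * a + b)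
  -- 2K comes from replacing ε by e(ε) in at most 2R logarithms, and 22 from 11√A ≤ 11 · 2√R.
  have hroot := (isLittleO_effDim_rpow (c := c₁) (α := α₁) (p := p) (q := 1 / 2) hc₁ hα₁
    hp2).const_mul_left (2 * K + 22)
  refine ⟨_, ((hsum.add hroot).add hpoly1).add hpoly2, ?_⟩
  filter_upwards [self_mem_nhdsWithin, hRtop.eventually_ge_atTop 1,
    (hRtop.const_mul_atTop hκ0).eventually_ge_atTop 1, hA, he0,
    hη.eventually (ge_mem_nhds one_pos), hd.eventually (ge_mem_nhds one_lt_two),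
    hd.eventually (lt_mem_nhds one_pos)]
    with ε (hε : 0 < ε) hR1 hκR hAε heε hη1 hdle hdpos
  have hRε : 0 < R ε := hR0 hε
  set x := R ε with hx
  have hsx0 : 0 < Real.sqrt x := Real.sqrt_pos.2 hRε
  set D := headCount μ (e ε) with hD
  set A := ∑ n ∈ head D, waterWeight (e ε) (μ n) with hAdef
  change (D : ℝ) / x ≤ 2 at hdle
  change 0 < (D : ℝ) / x at hdpos
  rw [div_le_iff₀ hRε] at hdle
  have hD0 : (0 : ℝ) < D := by
    by_contra hcon
    exact absurd hdpos (not_lt.2 (div_nonpos_of_nonpos_of_nonneg (not_lt.1 hcon) hRε.le))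
  have hA1 : 1 ≤ A := hκR.trans hAε
  have hAD : A ≤ D := by
    calc A ≤ ∑ n ∈ head D, (1 : ℝ) := Finset.sum_le_sum fun n _ => waterWeight_le_one _ _
      _ = D := by rw [Finset.sum_const, card_head, nsmul_eq_mul, mul_one]
  have hA0 : 0 < A := by linarith
  set s := Real.sqrt A with hs
  have hs1 : 1 ≤ s := Real.one_le_sqrt.2 hA1
  have hsA : s ≤ A := by
    have : s ^ 2 = A := Real.sq_sqrt hA0.le
    nlinarith
  have hsx : s ≤ 2 * x ^ (1 / 2 : ℝ) := by
    rw [← Real.sqrt_eq_rpow, hs]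
    refine Real.sqrt_le_iff.2 ⟨by positivity, ?_⟩
    rw [mul_pow, Real.sq_sqrt hRε.le]
    linarith
  have heinv : 1 / e ε ≤ 2 / c₁ * x ^ α₁ := by
    rw [hx, hRdef, effDim_rpow hc₁ hα₁ hε]
    have h1 : 1 / e ε = (1 + K / Real.sqrt x) / ε := by
      simp only [he]
      rw [one_div_div]
    have h2 : 2 / c₁ * (c₁ / ε) = 2 / ε := by field_simp
    rw [h1, h2]
    gcongr
    linarith
  set r := e ε / Real.sqrt x with hr
  have hr0 : 0 < r := by positivity
  have hrinv : 1 / r ≤ 2 / c₁ * x ^ b := by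
    have h1 : 1 / r = 1 / e ε * Real.sqrt x := by
      rw [hr]
      field_simp
    have h2 : Real.sqrt x ≤ x := Real.sqrt_le_iff.2 ⟨hRε.le, by nlinarith⟩
    rw [h1, hb, Real.rpow_add hRε, Real.rpow_one]
    calc 1 / e ε * Real.sqrt x ≤ (2 / c₁ * x ^ α₁) * x := by gcongr
      _ = _ := by ring
  set g := ⌈(C / (r / 4)) ^ (1 / α₁)⌉₊ with hg
  have hgle : (g : ℝ) ≤ E2 * x ^ a := grid_dim_le hR1 hC0 hr0 hc₁ hα₁ (by positivity) hrinv
  have hmain := log_coveringNum_le hpos heε hr0 hMle (F := head D) (G := head g) (A := A)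
    (ρ := ε) (mem_head_headCount_iff hanti hlim heε) rfl hA1
    (exists_head_card_le hα₁ hC0 hC (by positivity)) (radius_le hκ0 hRε hε le_rfl hAε)
  rw [sum_head, card_head] at hmain
  have hS : ∑ k ∈ Finset.range D, Real.log (μ k.succPNat / e ε) ≤
      ∑ k ∈ Finset.range D, Real.log (μ k.succPNat / ε) + 2 * K * x ^ (1 / 2 : ℝ) :=
    sum_log_div_le (fun k => hpos k.succPNat) hε hRε hK0.le hdle
  have hL1 : Real.log (1 + ⌈(s + 1) * s * M ^ 2 / e ε ^ 2⌉₊) ≤ Real.log (E1 * x ^ q) :=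
    Real.log_le_log (by positivity)
      (one_add_ceil_le hR1 hs1 (hsA.trans (hAD.trans hdle)) heε hα₁ heinv)
  have hL2 : Real.log (2 * (g * (4 * M * (g + 1) / r + 1)) + 1) ≤
      Real.log (E3 * x ^ (2 * a + b)) :=
    Real.log_le_log (by positivity)
      (grid_le hR1 hM0 hE20 (Nat.cast_nonneg g) hr0 ha0 (by positivity) hrinv hgle)
  have hDR : α₁ * (D * (Real.log x - Real.log D) + D) ≤ α₁ * x := by
    gcongr
    exact mul_sub_log_add_le hRε hD0
  change _ ≤ ∑ k ∈ Finset.range D, Real.log (μ k.succPNat / ε) -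
    (α₁ * (D * (Real.log x - Real.log D) + D) + c₂ / c₁ / p * x ^ p) +
    (2 * K + 22) * x ^ (1 / 2 : ℝ) + Real.log (E1 * x ^ q) + Real.log (E3 * x ^ (2 * a + b))
  linarith

lemma isLittleO_of_le_of_le {l : Filter ℝ} {f g₁ g₂ h : ℝ → ℝ} (h1 : g₁ =o[l] h)
    (h2 : g₂ =o[l] h) (hl : ∀ᶠ x in l, g₁ x ≤ f x) (hu : ∀ᶠ x in l, f x ≤ g₂ x) : f =o[l] h := by
  refine IsBigO.trans_isLittleO (g := fun x => ‖g₁ x‖ + ‖g₂ x‖) ?_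
    (h1.norm_left.add h2.norm_left)
  refine IsBigO.of_bound 1 ?_
  filter_upwards [hl, hu] with x hx1 hx2
  rw [one_mul, Real.norm_of_nonneg (add_nonneg (norm_nonneg (g₁ x)) (norm_nonneg (g₂ x))),
    Real.norm_eq_abs, Real.norm_eq_abs, Real.norm_eq_abs, abs_le]
  constructor
  · linarith [neg_abs_le (g₁ x), abs_nonneg (g₂ x)]
  · linarith [le_abs_self (g₂ x), abs_nonneg (g₁ x)]

end Entropy

/-! ### The main theorem: passage to base 2 and to powers of ε. -/

theorem mainTheorem9 (α₁ α₂ c₁ c₂ : ℝ) (hα₁ : 0 < α₁) (hα₂ : 0 < α₂)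
    (h₁₂ : α₁ < α₂) (h₂₁ : α₂ < α₁ + 1 / 2) (hc₁ : 0 < c₁)
    (μ : ℕ+ → ℝ) (hμ_pos : ∀ n, 0 < μ n) (hμ_anti : Antitone μ)
    (hμ : (fun n : ℕ+ => μ n - (c₁ / (n : ℝ) ^ α₁ + c₂ / (n : ℝ) ^ α₂))
      =o[atTop] fun n : ℕ+ => 1 / (n : ℝ) ^ α₂) :
    (∀ ε : ℝ, 0 < ε → coveringNum ε (ellipsoid μ) ≠ ⊤) ∧
    (fun ε : ℝ => metricEntropy ε (ellipsoid μ) -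
        (α₁ * c₁ ^ (1 / α₁) / Real.log 2 * ε ^ (-(1 / α₁)) +
          c₂ * c₁ ^ ((1 - α₂) / α₁) / (Real.log 2 * (α₁ - α₂ + 1)) *
            ε ^ (-((α₁ - α₂ + 1) / α₁))))
      =o[𝓝[>] 0] fun ε : ℝ => ε ^ (-((α₁ - α₂ + 1) / α₁)) := by
  have hsucc : Tendsto Nat.succPNat atTop atTop :=
    tendsto_atTop_mono' atTop (Eventually.of_forall fun k => le_rfl)
      (Filter.tendsto_atTop_atTop.2 fun n => ⟨n, fun k hk => by
        rw [← PNat.coe_le_coe, Nat.succPNat_coe]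
        omega⟩)
  have hν : (fun k : ℕ => μ k.succPNat - (c₁ / ((k : ℝ) + 1) ^ α₁ + c₂ / ((k : ℝ) + 1) ^ α₂))
      =o[atTop] fun k : ℕ => 1 / ((k : ℝ) + 1) ^ α₂ := by
    simpa [Function.comp_def] using hμ.comp_tendsto hsucc
  have hlim : Tendsto (fun k : ℕ => μ k.succPNat) atTop (𝓝 0) := by
    have h := (tendsto_relative h₁₂ hc₁ hν).mul
      ((tendsto_add_one_rpow_neg (δ := -α₁) (by linarith)).const_mul c₁)
    simp only [mul_zero] at h
    refine h.congr fun k => ?_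
    have hk : (0 : ℝ) < ((k : ℝ) + 1) ^ α₁ := by positivity
    rw [Real.rpow_neg (by positivity)]
    field_simp
  have hpred : Tendsto PNat.natPred atTop atTop := tendsto_atTop_atTop.2 fun m =>
    ⟨m.succPNat, fun n hn => by
      have h1 := (PNat.coe_le_coe _ _).2 hn
      rw [Nat.succPNat_coe] at h1
      have h2 := PNat.natPred_add_one n
      omega⟩
  have hlim' : Tendsto μ atTop (𝓝 0) := (hlim.comp hpred).congr fun n => by
    rw [Function.comp_apply, PNat.succPNat_natPred]
  have hfin : ∀ ε : ℝ, 0 < ε → coveringNum ε (ellipsoid μ) ≠ ⊤ := fun ε hε =>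
    coveringNum_ellipsoid_ne_top hμ_pos hμ_anti hlim' hε
  refine ⟨hfin, ?_⟩
  obtain ⟨g₁, hg₁, hl⟩ := log_lower_le_entropy hμ_pos hfin hα₁ h₁₂ (by linarith) hc₁ hν
  obtain ⟨g₂, hg₂, hu⟩ := entropy_le_log_upper hμ_pos hμ_anti hlim hα₁ h₁₂ h₂₁ hc₁ hν
  have hmain := (isLittleO_of_le_of_le hg₁ hg₂ hl hu).const_mul_left (1 / Real.log 2)
  set p := α₁ - α₂ + 1 with hp
  have hp0 : 0 < p := by linarith
  have hlog2 : 0 < Real.log 2 := Real.log_pos one_lt_two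
  have hRpow : ∀ ε : ℝ, 0 < ε → effDim c₁ α₁ ε ^ p = c₁ ^ (p / α₁) * ε ^ (-(p / α₁)) := by
    intro ε hε
    rw [effDim, ← Real.rpow_mul (by positivity), Real.div_rpow hc₁.le hε.le, Real.rpow_neg hε.le,
      one_div_mul_eq_div]
    rfl
  have hR : ∀ ε : ℝ, 0 < ε → effDim c₁ α₁ ε = c₁ ^ (1 / α₁) * ε ^ (-(1 / α₁)) := by
    intro ε hε
    rw [effDim, Real.div_rpow hc₁.le hε.le, Real.rpow_neg hε.le]
    rfl
  refine (hmain.congr' (f₂ := fun ε : ℝ => metricEntropy ε (ellipsoid μ) -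
        (α₁ * c₁ ^ (1 / α₁) / Real.log 2 * ε ^ (-(1 / α₁)) +
          c₂ * c₁ ^ ((1 - α₂) / α₁) / (Real.log 2 * p) * ε ^ (-(p / α₁))))
      (g₂ := fun ε : ℝ => c₁ ^ (p / α₁) * ε ^ (-(p / α₁))) ?_ ?_).trans_isBigO ?_
  · filter_upwards [self_mem_nhdsWithin] with ε (hε : 0 < ε)
    -- (1 - α₂)/α₁ = p/α₁ - 1; the division by c₁ is the one in the coefficient c₂/c₁.
    have hexp : c₁ ^ ((1 - α₂) / α₁) = c₁ ^ (p / α₁) / c₁ := by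
      rw [← Real.rpow_sub_one hc₁.ne']
      congr 1
      rw [hp]
      field_simp
      ring
    rw [hRpow ε hε, hR ε hε, metricEntropy, Real.logb, hexp]
    field_simp
  · filter_upwards [self_mem_nhdsWithin] with ε hε
    exact hRpow ε hε
  · exact (isBigO_refl _ _).const_mul_left _
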